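/- For functions $f,g:\mathbb{N}\to\mathbb{N}$ with $f(n),g(n)\ge 1$ for $n\ge 1$, write $g\preceq f$ if there is a positive integer $C$ with $g(n)\le f(Cn)$ for all $n\ge 1$, and $f\sim g$ (asymptotic equivalence) if $f\preceq g$ and $g\preceq f$. For $F:\mathbb{N}\to\mathbb{N}$ put $F'(0)=F(0)$ and $F'(n)=F(n)-F(n-1)$ for $n\ge 1$. Growth functions are defined as follows. (a) If $A$ is a nonzero associative algebra (not necessarily unital) over a field $k$ and $V$ is a finite-dimensional subspace generating $A$ as a (not necessarily unital) $k$-algebra, then $d_V(n)$ is the dimension of the span of all $m$-fold products of elements of $V$ with $1\le m\le n$; this includes unital algebras generated by a finite-dimensional subspace containing $1$. (b) If $S$ is a nonempty semigroup with finite generating set $X$, then $d_X(n)$ is the number of elements of $\bigcup_{m=1}^{n}X^m$. (c) If $X$ is a finite alphabet and $W$ is a set of nonempty words in $X$, the hereditary language $L_W(X)$ is the set of all words in $X$ (including the empty word) having no factor (contiguous subword) in $W$, and its growth function $d(n)$ is the number of words of length at most $n$ in it. Call $F:\mathbb{N}\to\mathbb{N}$ admissible if it is a positive constant function, or a linear function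 $F(n)=an+b$ with integers $a\ge 1$, $b\ge 0$, or a weakly increasing function such that (i) $F'(n)\ge n+1$ for all $n\ge 0$, and (ii) $F'(m)\le F'(n)^2$ for all $n\ge 1$ and $m\in\{n,\ldots,2n\}$. **Theorem.** Let $k$ be a field. Every growth function of a finitely generated $k$-algebra is asymptotically equivalent to an admissible function. Conversely, every admissible function is asymptotically equivalent to the growth function of a hereditary language. In particular, for a weakly increasing function $g:\mathbb{N}\to\mathbb{N}$ with $g(n)\ge 1$ for all $n\ge 1$, the following are equivalent: $g$ is asymptotically equivalent to an admissible function; to the growth function of a finitely generated $k$-algebra; to the growth function of a finitely generated unital $k$-algebra with respect to a subspace containing $1$; to the growth function of a finitely generated semigroup; to the growth function of a hereditary language. -/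

import Mathlib

universe u v w

namespace AlgGrowth

/-- `g ≼ f`: there is a positive integer `C` with `g n ≤ f (C n)` for all positive integers `n`. -/
def AsympLE (g f : ℕ → ℕ) : Prop :=
  ∃ C : ℕ, 1 ≤ C ∧ ∀ n : ℕ, 1 ≤ n → g n ≤ f (C * n)

/-- Asymptotic equivalence of functions. -/
def AsympEquiv (f g : ℕ → ℕ) : Prop :=
  AsympLE f g ∧ AsympLE g f

/-- The discrete derivative `F' 0 = F 0`, `F' n = F n - F (n - 1)`, with values in `ℤ`. -/
def discreteDeriv (F : ℕ → ℕ) : ℕ → ℤ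
  | 0 => (F 0 : ℤ)
  | n + 1 => (F (n + 1) : ℤ) - (F n : ℤ)

/-- Positive constant functions. -/
def IsConstantFun (F : ℕ → ℕ) : Prop :=
  ∃ c : ℕ, 1 ≤ c ∧ ∀ n, F n = c

/-- (Non-constant) linear functions. -/
def IsLinearFun (F : ℕ → ℕ) : Prop :=
  ∃ a b : ℕ, 1 ≤ a ∧ ∀ n, F n = a * n + b

/-- Weakly increasing functions with `F' n ≥ n + 1` for all `n`, and `F' m ≤ (F' n) ^ 2`
whenever `n ≥ 1` and `n ≤ m ≤ 2 n`. -/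
def IsGapFun (F : ℕ → ℕ) : Prop :=
  Monotone F ∧
  (∀ n : ℕ, (n : ℤ) + 1 ≤ discreteDeriv F n) ∧
  (∀ n m : ℕ, 1 ≤ n → n ≤ m → m ≤ 2 * n → discreteDeriv F m ≤ discreteDeriv F n ^ 2)

/-- The three kinds of functions together. -/
def IsAdmissible (F : ℕ → ℕ) : Prop :=
  IsConstantFun F ∨ IsLinearFun F ∨ IsGapFun F

/-- For `k ≥ 1`, the set `X ^ k` of all `k`-fold products of elements of `X`
(the value at `k = 0` is not used). -/
def powSet {S : Type w} [Mul S] (X : Set S) : ℕ → Set S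
  | 0 => ∅
  | 1 => X
  | k + 2 => Set.image2 (fun a x => a * x) (powSet X (k + 1)) X

/-- The union of the sets `X ^ k` for `1 ≤ k ≤ n`. -/
def ball {S : Type w} [Mul S] (X : Set S) (n : ℕ) : Set S :=
  {a | ∃ k : ℕ, 1 ≤ k ∧ k ≤ n ∧ a ∈ powSet X k}

/-- The growth function `d_X` of a semigroup with respect to `X`. -/
noncomputable def semigroupGrowth {S : Type w} [Semigroup S] (X : Set S) (n : ℕ) : ℕ :=
  (ball X n).ncard

/-- The growth function `d_V` of an associative, not necessarily unital, algebra with respect to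
a subspace `V`: the dimension of the span of all `m`-fold products in `V`, `1 ≤ m ≤ n`. -/
noncomputable def algebraGrowth {k : Type u} {A : Type v} [Field k] [NonUnitalRing A] [Module k A]
    (V : Submodule k A) (n : ℕ) : ℕ :=
  Module.finrank k (Submodule.span k (ball (V : Set A) n))

/-- The hereditary language of all words without a subword (factor) in `W`. -/
def hereditaryLanguage {X : Type w} (W : Set (List X)) : Set (List X) :=
  {x | ∀ y ∈ W, ¬ y <:+: x}

/-- The number of words of length at most `n` in the hereditary language given by `W`. -/
noncomputable def languageGrowth {X : Type w} (W : Set (List X)) (n : ℕ) : ℕ :=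
  {x : List X | x ∈ hereditaryLanguage W ∧ x.length ≤ n}.ncard

/-- `f` is a growth function of a finitely generated nonzero associative `k`-algebra
(which need not have a unit), with respect to some finite-dimensional generating subspace. -/
def IsAlgebraGrowth (k : Type u) [Field k] (f : ℕ → ℕ) : Prop :=
  ∃ (A : Type v) (_ : NonUnitalRing A) (_ : Module k A) (_ : IsScalarTower k A A)
    (_ : SMulCommClass k A A) (_ : Nontrivial A) (V : Submodule k A),
    Module.Finite k V ∧ NonUnitalAlgebra.adjoin k (V : Set A) = ⊤ ∧ f = algebraGrowth V

/-- `f` is a growth function of a finitely generated nonzero unital associative `k`-algebra, with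
respect to some finite-dimensional generating subspace that contains `1`. -/
def IsUnitalAlgebraGrowth (k : Type u) [Field k] (f : ℕ → ℕ) : Prop :=
  ∃ (A : Type v) (_ : Ring A) (_ : Algebra k A) (_ : Nontrivial A) (V : Submodule k A),
    Module.Finite k V ∧ (1 : A) ∈ V ∧ Algebra.adjoin k (V : Set A) = ⊤ ∧ f = algebraGrowth V

/-- `f` is a growth function of a finitely generated nonempty semigroup, with respect to some
finite generating set. -/
def IsSemigroupGrowth (f : ℕ → ℕ) : Prop :=
  ∃ (S : Type w) (_ : Semigroup S) (_ : Nonempty S) (X : Set S),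
    X.Finite ∧ Subsemigroup.closure X = ⊤ ∧ f = semigroupGrowth X

/-- `f` is the growth function of a nonempty hereditary language over a finite alphabet
(the language is nonempty exactly when the empty word is not forbidden). -/
def IsLanguageGrowth (f : ℕ → ℕ) : Prop :=
  ∃ (X : Type w) (_ : Finite X) (W : Set (List X)), [] ∉ W ∧ f = languageGrowth W

end AlgGrowth

namespace AlgGrowth

/-! Both directions pass through factor-closed languages, where growth is a matter of counting
words.

From algebras to admissible functions: adjoin a unit, take a basis of the generating space as
alphabet, and order words by `wordCode`, which respects length and concatenation. The words whose
values do not reduce to smaller words form a factor-closed language, and they give bases compatible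
with the length filtration (`finrank_wordSpan`). So, up to the empty word, the algebra grows like a
language. Let p(n) be the number of its words of length n. If p vanishes somewhere, the growth is
eventually constant. If p(d) ≤ d for some d, Bergman's gap argument makes long words periodic away
from their ends, so p is bounded and the growth is linear
(`exists_complexity_le_of_complexity_le_self`). Otherwise p(n) ≥ n + 1, and p(m) ≤ p(n)² for n ≤ m ≤
2n because a prefix and a suffix of length n determine the word (`complexity_le_sq`).

From a gap function F to a language (`IsGapFun.exists_language`): the dyadic increments S_k of F
satisfy S_{k+1} ≤ 2 S_k², so numbers c_k of the order of the fifth root of S_k can be chosen with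
c_{k+1} ≤ c_k². This allows sets U_k of at least c_k words of length 2^k, where U_{k+1} normally
consists of c_{k+1} products of two words of U_k. Products of five blocks supply the S_k words
needed at scale 2^k, and adding them one at a time with their factors hits the target up to a
quadratic error. Later levels must not create too many short words: these are factors of products of
two blocks, about c² N² many for c blocks of length N. This is at most of order c⁴, hence negligible
against c⁵, if N < 2c; when c is smaller, the level consists of words with a single exceptional
letter, which have only quadratically many short factors. Quadratic errors are harmless since F
itself grows at least quadratically.

Languages become semigroups by sending forbidden products to a zero, semigroups become algebras by
linearization, and languages become unital monomial algebras through operators on words. This closes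
the circle of equivalences. -/

lemma AsympLE.trans {f g h : ℕ → ℕ} (hfg : AsympLE f g) (hgh : AsympLE g h) : AsympLE f h := by
  obtain ⟨C, hC, h1⟩ := hfg
  obtain ⟨D, hD, h2⟩ := hgh
  refine ⟨D * C, Nat.mul_pos hD hC, fun n hn => (h1 n hn).trans ?_⟩
  rw [mul_assoc]
  exact h2 _ (Nat.mul_pos hC hn)

lemma AsympEquiv.symm {f g : ℕ → ℕ} (h : AsympEquiv f g) : AsympEquiv g f := ⟨h.2, h.1⟩

lemma AsympEquiv.trans {f g h : ℕ → ℕ} (hfg : AsympEquiv f g) (hgh : AsympEquiv g h) :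
    AsympEquiv f h :=
  ⟨hfg.1.trans hgh.1, hgh.2.trans hfg.2⟩

/-- Functions that agree at all positive integers are equivalent. -/
lemma AsympEquiv.of_eq {f g : ℕ → ℕ} (h : ∀ n, 1 ≤ n → f n = g n) : AsympEquiv f g :=
  ⟨⟨1, le_rfl, fun n hn => by rw [one_mul, h n hn]⟩,
    ⟨1, le_rfl, fun n hn => by rw [one_mul, h n hn]⟩⟩

/-! ### Factor-closed languages and their complexity. -/

section Languages

variable {X : Type w}

/-- A set of words that contains all factors of its elements. -/
def FactorClosed (L : Set (List X)) : Prop :=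
  ∀ ⦃x y : List X⦄, x ∈ L → y <:+: x → y ∈ L

/-- The number of words of length `n` in a language. -/
noncomputable def complexity (L : Set (List X)) (n : ℕ) : ℕ :=
  {x : List X | x ∈ L ∧ x.length = n}.ncard

/-- The number of words of length at most `n` in a language. -/
noncomputable def wordCount (L : Set (List X)) (n : ℕ) : ℕ :=
  {x : List X | x ∈ L ∧ x.length ≤ n}.ncard

lemma factorClosed_hereditaryLanguage (W : Set (List X)) :
    FactorClosed (hereditaryLanguage W) :=
  fun _ _ hx hyx z hz hzy => hx z hz (hzy.trans hyx)

lemma hereditaryLanguage_compl {L : Set (List X)} (hL : FactorClosed L) :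
    hereditaryLanguage Lᶜ = L := by
  ext x
  refine ⟨fun hx => ?_, fun hx y hy hyx => hy (hL hx hyx)⟩
  by_contra h
  exact hx x h (List.infix_refl x)

lemma languageGrowth_compl {L : Set (List X)} (hL : FactorClosed L) :
    languageGrowth Lᶜ = wordCount L := by
  funext n
  rw [languageGrowth, hereditaryLanguage_compl hL, wordCount]

lemma nil_mem_hereditaryLanguage {W : Set (List X)} (hW : [] ∉ W) :
    [] ∈ hereditaryLanguage W := by
  intro y hy h
  rw [List.infix_nil] at h
  exact hW (h ▸ hy)

lemma wordCount_zero (L : Set (List X)) : wordCount L 0 = complexity L 0 := by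
  simp [wordCount, complexity]

lemma complexity_zero {L : Set (List X)} (h : [] ∈ L) : complexity L 0 = 1 := by
  rw [complexity, Set.ncard_eq_one]
  refine ⟨[], ?_⟩
  ext x
  simp only [Set.mem_ofPred_eq, List.length_eq_zero_iff, Set.mem_singleton_iff]
  exact ⟨fun h => h.2, fun hx => ⟨hx ▸ h, hx⟩⟩

variable [Finite X]

lemma finite_words_length_le (L : Set (List X)) (n : ℕ) :
    {x : List X | x ∈ L ∧ x.length ≤ n}.Finite :=
  (List.finite_length_le X n).subset fun _ hx => hx.2

lemma finite_words_length_eq (L : Set (List X)) (n : ℕ) :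
    {x : List X | x ∈ L ∧ x.length = n}.Finite :=
  (List.finite_length_eq X n).subset fun _ hx => hx.2

lemma wordCount_mono (L : Set (List X)) : Monotone (wordCount L) := fun _ n hmn =>
  Set.ncard_le_ncard (fun _ hx => ⟨hx.1, hx.2.trans hmn⟩) (finite_words_length_le L n)

lemma wordCount_succ (L : Set (List X)) (n : ℕ) :
    wordCount L (n + 1) = wordCount L n + complexity L (n + 1) := by
  rw [wordCount, wordCount, complexity, ← Set.ncard_union_eq _ (finite_words_length_le L n)
    (finite_words_length_eq L (n + 1))]
  · congr 1
    ext x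
    simp only [Set.mem_ofPred_eq, Set.mem_union]
    grind
  · rw [Set.disjoint_left]
    rintro x ⟨_, h1⟩ ⟨_, h2⟩
    omega

lemma discreteDeriv_wordCount (L : Set (List X)) (n : ℕ) :
    discreteDeriv (wordCount L) n = complexity L n := by
  cases n with
  | zero => simp [discreteDeriv, wordCount_zero]
  | succ n => simp [discreteDeriv, wordCount_succ]

/-- A word of length `m` with `n ≤ m ≤ 2 n` is determined by its prefix and its suffix of
length `n`. -/
lemma complexity_le_sq {L : Set (List X)} (hL : FactorClosed L) {n m : ℕ} (hnm : n ≤ m)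
    (hm : m ≤ 2 * n) : complexity L m ≤ complexity L n ^ 2 := by
  rw [sq, complexity, complexity, ← Set.ncard_prod]
  refine Set.ncard_le_ncard_of_injOn (fun x => (x.take n, x.drop (m - n))) ?_ ?_
    ((finite_words_length_eq L n).prod (finite_words_length_eq L n))
  · rintro x ⟨hx, hxm⟩
    refine ⟨⟨hL hx (List.take_prefix _ _).isInfix, ?_⟩,
      ⟨hL hx (List.drop_suffix _ _).isInfix, ?_⟩⟩
    · simp; omega
    · simp; omega
  · rintro x ⟨hx, hxm⟩ y ⟨hy, hym⟩ hxy
    simp only [Prod.mk.injEq] at hxy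
    apply List.ext_getElem (by omega)
    intro i hi hi'
    by_cases hin : i < n
    · have := congrArg (fun l => l[i]?) hxy.1
      simpa [hin, hi, hi'] using this
    · have := congrArg (fun l => l[i - (m - n)]?) hxy.2
      have e : m - n + (i - (m - n)) = i := by omega
      simpa [e, hi, hi'] using this

/-- A vanishing value of the complexity makes all further ones vanish. -/
lemma complexity_eq_zero_of_le {L : Set (List X)} (hL : FactorClosed L) {n m : ℕ} (hnm : n ≤ m)
    (h : complexity L n = 0) : complexity L m = 0 := by
  rw [complexity, Set.ncard_eq_zero (finite_words_length_eq _ _)] at h ⊢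
  rw [Set.eq_empty_iff_forall_notMem] at h ⊢
  rintro x ⟨hx, hxm⟩
  exact h (x.take n) ⟨hL hx (List.take_prefix _ _).isInfix, by simp; omega⟩

end Languages

/-! ### The gap theorem: p(d) ≤ d for one d forces bounded complexity. -/

section Gap

/-- Let `a` be a sequence in which at most `d` windows of length `d` starting at positions up to
`n - d` are pairwise different. Then `a` is periodic, with period at most `d`, between some
position `i ≤ d` and some position `e ≥ n - d`. -/
lemma exists_period_of_few_windows {α : Type*} (a : ℕ → α) {d n : ℕ} (hn : 2 * d ≤ n)
    (H : ∀ I : Finset ℕ, (∀ i ∈ I, i + d ≤ n) →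
      (∀ i ∈ I, ∀ j ∈ I, i < j → ¬ ∀ t < d, a (i + t) = a (j + t)) → I.card ≤ d) :
    ∃ i p e, i ≤ d ∧ 1 ≤ p ∧ p ≤ d ∧ i + p ≤ e ∧ e ≤ n ∧ n ≤ e + d ∧
      ∀ t, i ≤ t → t + p < e → a t = a (t + p) := by
  classical
  -- Two of the d + 1 windows starting at 0, …, d coincide, and the distance of their starting
  -- points is a local period.
  have hex : ∃ p, 1 ≤ p ∧ ∃ i, i + p ≤ d ∧ ∀ t < d, a (i + t) = a (i + p + t) := by
    by_contra hcon
    push Not at hcon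
    have := H (Finset.range (d + 1)) (fun i hi => by simp at hi; omega) ?_
    · simp at this
    · intro i hi j hj hij h
      simp only [Finset.mem_range] at hi hj
      obtain ⟨t, ht, h'⟩ := hcon (j - i) (by omega) i (by omega)
      apply h'
      rw [h t ht]
      congr 1
      omega
  -- Minimality of `p` makes the windows starting in [i, i + p) pairwise different; `e` below is the
  -- end of the maximal `p`-periodic run from `i`.
  obtain ⟨p, ⟨hp1, i, hip, hwin⟩, hmin⟩ : ∃ p, (1 ≤ p ∧ ∃ i, i + p ≤ d ∧
      ∀ t < d, a (i + t) = a (i + p + t)) ∧ ∀ q < p, ¬ (1 ≤ q ∧ ∃ i, i + q ≤ d ∧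
      ∀ t < d, a (i + t) = a (i + q + t)) :=
    ⟨Nat.find hex, Nat.find_spec hex, fun q hq => Nat.find_min hex hq⟩
  let P : ℕ → Prop := fun e => ∀ t, i ≤ t → t + p < e → a t = a (t + p)
  have hP0 : P (i + d + p) := by
    intro t h1 h2
    have := hwin (t - i) (by omega)
    rw [show i + (t - i) = t by omega, show i + p + (t - i) = t + p by omega] at this
    exact this
  obtain ⟨e, he, hPe, hemax, heid⟩ : ∃ e ≤ n, P e ∧ (∀ k, e < k → k ≤ n → ¬ P k) ∧
      i + d + p ≤ e := by
    refine ⟨Nat.findGreatest P n, Nat.findGreatest_le n,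
      Nat.findGreatest_spec (m := i + d + p) (by omega) hP0, fun k hk hkn =>
      Nat.findGreatest_is_greatest hk hkn, Nat.le_findGreatest (by omega) hP0⟩
  refine ⟨i, p, e, by omega, hp1, by omega, by omega, he, ?_, hPe⟩
  by_contra hlt
  have hbreak : a (e - p) ≠ a e := by
    intro hae
    apply hemax (e + 1) (by omega) (by omega)
    intro t h1 h2
    rcases Nat.lt_or_ge (t + p) e with h | h
    · exact hPe t h1 h
    · have : t = e - p := by omega
      subst this
      rw [hae]
      congr 1
      omega
  -- `N s` counts the letter `a e` in the block of length `p` at `s`. It is constant along the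
  -- periodic run and rises by one for the block ending at the break `e`.
  let N : ℕ → ℕ := fun s => ∑ t ∈ Finset.range p, if a (s + t) = a e then 1 else 0
  have hN : ∀ s, (if a s = a e then 1 else 0) + N (s + 1)
      = N s + if a (s + p) = a e then 1 else 0 := by
    intro s
    have h1 := Finset.sum_range_succ (fun t => if a (s + t) = a e then 1 else 0) p
    have h2 := Finset.sum_range_succ' (fun t => if a (s + t) = a e then 1 else 0) p
    rw [h2] at h1
    simp only [N]
    rw [← h1, add_comm]
    simp only [add_zero]
    congr 1
    refine Finset.sum_congr rfl fun t _ => ?_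
    rw [show s + 1 + t = s + (t + 1) by omega]
  have hNconst : ∀ s, i ≤ s → s + p ≤ e → N s = N (e - p) := by
    intro s hs hse
    obtain ⟨c, hc⟩ : ∃ c, e - p = s + c := ⟨e - p - s, by omega⟩
    rw [hc]
    clear hse
    induction c generalizing s with
    | zero => rfl
    | succ c ih =>
      rw [show s + (c + 1) = s + 1 + c by omega, ← ih (s + 1) (by omega) (by omega)]
      have := hN s
      rw [hPe s hs (by omega)] at this
      omega
  have hNe : N (e - p + 1) = N (e - p) + 1 := by
    have := hN (e - p)
    rw [if_neg hbreak, show e - p + p = e by omega, if_pos rfl] at this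
    omega
  -- A window at `s'` containing `e` differs from every earlier one starting at or after `i`. If it
  -- also contains `e - p`, it shows a violation of the period that the earlier one cannot have; if
  -- it starts at `e - p + 1`, the counts `N` differ.
  have hkey : ∀ s s', i ≤ s → s + (e - s') < e → e < s' + d → s' + p ≤ e + 1 →
      ¬ ∀ t < d, a (s + t) = a (s' + t) := by
    intro s s' h1 h2 h3 h4 hw
    rcases Nat.lt_or_ge e (s' + p) with h | h
    · have hs' : s' = e - p + 1 := by omega
      have : N s = N s' := Finset.sum_congr rfl fun t ht => by
        rw [Finset.mem_range] at ht
        rw [hw t (by omega)]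
      rw [hNconst s h1 (by omega), hs', hNe] at this
      omega
    · apply hbreak
      have e1 := hw (e - s') (by omega)
      have e2 := hw (e - s' - p) (by omega)
      have e3 := hPe (s + (e - s' - p)) (by omega) (by omega)
      rw [show s' + (e - s') = e by omega] at e1
      rw [show s' + (e - s' - p) = e - p by omega] at e2
      rw [show s + (e - s' - p) + p = s + (e - s') by omega] at e3
      rw [← e1, ← e2, e3]
  -- These are p + (d - p + 1) = d + 1 pairwise different windows, one more than `H` permits.
  have hcard := H (Finset.Ico i (i + p) ∪ Finset.Ico (e + 1 - d) (e + 2 - p)) ?_ ?_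
  · rw [Finset.card_union_of_disjoint] at hcard
    · simp only [Nat.card_Ico] at hcard
      omega
    · rw [Finset.disjoint_left]
      intro x hx hx'
      simp only [Finset.mem_Ico] at hx hx'
      omega
  · intro x hx
    simp only [Finset.mem_union, Finset.mem_Ico] at hx
    omega
  · intro x hx y hy hxy
    simp only [Finset.mem_union, Finset.mem_Ico] at hx hy
    rcases hy with hy | hy
    · intro hw
      refine hmin (y - x) (by omega) ⟨by omega, x, by omega, fun t ht => ?_⟩
      rw [hw t ht]
      congr 1
      omega
    · exact hkey x y (by omega) (by omega) (by omega) (by omega)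

variable {X : Type w} [Finite X]

/-- A factor closed language with at most `d` words of some length `d` has boundedly many words
of each length. -/
lemma exists_complexity_le_of_complexity_le_self {L : Set (List X)} (hL : FactorClosed L) {d : ℕ}
    (hd : complexity L d ≤ d) : ∃ K, ∀ n, complexity L n ≤ K := by
  classical
  let T : Set (ℕ × ℕ × List X × List X) :=
    Set.Iic d ×ˢ Set.Iic d ×ˢ {x | x.length ≤ 2 * d} ×ˢ {x | x.length ≤ d}
  have hT : T.Finite := (Set.finite_Iic d).prod ((Set.finite_Iic d).prod
    ((List.finite_length_le X _).prod (List.finite_length_le X _)))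
  refine ⟨{x : List X | x.length ≤ 2 * d}.ncard + T.ncard, fun n => ?_⟩
  rcases Nat.lt_or_ge n (2 * d) with hn | hn
  · refine le_trans (Set.ncard_le_ncard ?_ (List.finite_length_le X _)) (Nat.le_add_right _ _)
    rintro x ⟨_, hx⟩
    simp only [Set.mem_ofPred_eq]
    omega
  refine le_trans ?_ (Nat.le_add_left _ _)
  have hper : ∀ x : List X, x ∈ L ∧ x.length = n → ∃ i p e, i ≤ d ∧ 1 ≤ p ∧ p ≤ d ∧ i + p ≤ e ∧
      e ≤ n ∧ n ≤ e + d ∧ ∀ t, i ≤ t → t + p < e → x[t]? = x[t + p]? := by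
    rintro x ⟨hx, hxn⟩
    refine exists_period_of_few_windows (fun t => x[t]?) hn fun I hI hinj => ?_
    refine le_trans ?_ hd
    rw [← Set.ncard_coe_finset I]
    refine Set.ncard_le_ncard_of_injOn (fun i => (x.drop i).take d) ?_ ?_
      (finite_words_length_eq L d)
    · intro i hi
      refine ⟨hL hx ((List.take_prefix _ _).isInfix.trans (List.drop_suffix _ _).isInfix), ?_⟩
      have := hI i hi
      simp
      omega
    · have main : ∀ i ∈ I, ∀ j ∈ I, i < j → (x.drop i).take d ≠ (x.drop j).take d := by
        intro i hi j hj hij h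
        refine hinj i hi j hj hij fun t ht => ?_
        have := congrArg (fun l => l[t]?) h
        simpa [ht] using this
      intro i hi j hj hij
      rcases lt_trichotomy i j with h | h | h
      · exact absurd hij (main i hi j hj h)
      · exact h
      · exact absurd hij.symm (main j hj i hi h)
  choose! i p e h1 h2 h3 h4 h5 h6 h7 using hper
  -- A word of length n is recovered from its bounded ends and its period; `e` need not be recorded,
  -- as the length of the suffix gives it.
  refine Set.ncard_le_ncard_of_injOn
    (fun x => (i x, p x, x.take (i x + p x), x.drop (e x))) ?_ ?_ hT
  · intro x hx
    refine ⟨h1 x hx, h3 x hx, ?_, ?_⟩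
    · have := h1 x hx
      have := h3 x hx
      simp
      omega
    · have := h6 x hx
      have := hx.2
      simp
      omega
  · intro x hx y hy hxy
    simp only [Prod.mk.injEq] at hxy
    obtain ⟨hi, hp, ht, hd'⟩ := hxy
    have he : e x = e y := by
      have := congrArg List.length hd'
      have := h5 x hx
      have := h5 y hy
      have := hx.2
      have := hy.2
      simp at *
      omega
    apply List.ext_getElem?
    intro t
    induction t using Nat.strong_induction_on with
    | _ t ih =>
    rcases Nat.lt_or_ge t (i x + p x) with hlt | hge
    · have := congrArg (fun l => l[t]?) ht
      simp only [List.getElem?_take, hlt, ← hi, ← hp, if_true] at this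
      exact this
    rcases Nat.lt_or_ge t (e x) with hlt | hge'
    · have hpx := h2 x hx
      have e1 := h7 x hx (t - p x) (by omega) (by omega)
      have e2 := h7 y hy (t - p x) (by omega) (by omega)
      rw [← hp] at e2
      rw [show t - p x + p x = t by omega] at e1 e2
      rw [← e1, ← e2]
      exact ih _ (by omega)
    · have := congrArg (fun l => l[t - e x]?) hd'
      simp only [List.getElem?_drop, ← he] at this
      rwa [show e x + (t - e x) = t by omega] at this

end Gap

/-! ### The trichotomy for the growth of factor-closed languages. -/

section LanguageToAdmissible

variable {X : Type w} [Finite X]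

/-- The function that counts the nonempty words of length at most `n` in a factor closed language
with at least one letter is equivalent to an admissible function. -/
theorem exists_admissible_of_wordCount {L : Set (List X)} (hL : FactorClosed L) (hnil : [] ∈ L)
    {f : ℕ → ℕ} (hf : ∀ n, wordCount L n = f n + 1) (hf1 : 1 ≤ f 1) :
    ∃ F, IsAdmissible F ∧ AsympEquiv f F := by
  have hmono := wordCount_mono L
  have h0 : wordCount L 0 = 1 := by rw [wordCount_zero, complexity_zero hnil]
  by_cases hzero : ∃ n, complexity L n = 0
  · obtain ⟨n₀, hn₀⟩ := hzero
    have hn1 : 1 ≤ n₀ := by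
      rcases Nat.eq_zero_or_pos n₀ with rfl | h
      · rw [complexity_zero hnil] at hn₀
        omega
      · exact h
    have hconst : ∀ n, n₀ ≤ n → wordCount L n = wordCount L n₀ := by
      intro n hn
      induction n, hn using Nat.le_induction with
      | base => rfl
      | succ n hn ih =>
        rw [wordCount_succ, ih, complexity_eq_zero_of_le hL (by omega) hn₀, add_zero]
    refine ⟨fun _ => f n₀, Or.inl ⟨f n₀, ?_, fun _ => rfl⟩, ⟨1, le_rfl, fun n _ => ?_⟩,
      ⟨n₀, hn1, fun n hn => ?_⟩⟩
    · have := hmono hn1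
      rw [hf, hf] at this
      omega
    · have := hmono (le_max_left n n₀)
      rw [hconst _ (le_max_right _ _), hf, hf] at this
      exact Nat.le_of_succ_le_succ this
    · have := hconst (n₀ * n) (Nat.le_mul_of_pos_right _ hn)
      rw [hf, hf] at this
      exact (Nat.succ_injective this).ge
  push Not at hzero
  have hlow : ∀ n, n + 1 ≤ wordCount L n := by
    intro n
    induction n with
    | zero => exact h0.ge
    | succ n ih =>
      have := hzero (n + 1)
      rw [wordCount_succ]
      omega
  by_cases hgap : ∃ d, complexity L d ≤ d
  · obtain ⟨d, hd⟩ := hgap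
    obtain ⟨K, hK⟩ := exists_complexity_le_of_complexity_le_self hL hd
    have hup : ∀ n, wordCount L n ≤ 1 + K * n := by
      intro n
      induction n with
      | zero => exact h0.le
      | succ n ih =>
        have := hK (n + 1)
        rw [wordCount_succ, Nat.mul_succ]
        omega
    refine ⟨fun n => n, Or.inr (Or.inl ⟨1, 0, le_rfl, fun n => by simp⟩),
      ⟨K + 1, by omega, fun n _ => ?_⟩, ⟨1, le_rfl, fun n _ => ?_⟩⟩
    · have := hup n
      rw [hf] at this
      change f n ≤ (K + 1) * n
      rw [Nat.succ_mul]
      omega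
    · have := hlow n
      rw [hf] at this
      rw [one_mul]
      exact Nat.le_of_succ_le_succ this
  · push Not at hgap
    refine ⟨wordCount L, Or.inr (Or.inr ⟨hmono, fun n => ?_, fun n m _ hnm hm => ?_⟩),
      ⟨1, le_rfl, fun n _ => ?_⟩, ⟨2, by norm_num, fun n hn => ?_⟩⟩
    · rw [discreteDeriv_wordCount]
      exact_mod_cast hgap n
    · rw [discreteDeriv_wordCount, discreteDeriv_wordCount]
      exact_mod_cast complexity_le_sq hL hnm hm
    · rw [one_mul, hf]
      omega
    -- Doubling the argument makes up for the empty word, which `wordCount` counts and `f` does not.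
    · obtain ⟨m, rfl⟩ : ∃ m, n = m + 1 := ⟨n - 1, by omega⟩
      have h1 := wordCount_succ L (2 * m + 1)
      have h2 := hgap (2 * m + 1 + 1)
      have h3 := hmono (show m + 1 ≤ 2 * m + 1 by omega)
      have h4 := hf (2 * m + 1 + 1)
      rw [show 2 * (m + 1) = 2 * m + 1 + 1 by ring]
      omega

end LanguageToAdmissible

/-! ### A well-ordering of words compatible with concatenation. -/

section Code

/-- The number with the digits `x + 1`, where `x` runs over the letters of a word. Comparing these
numbers amounts to comparing the lengths of two words first, and then the words
lexicographically from the right. -/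
def wordCode {d : ℕ} : List (Fin d) → ℕ
  | [] => 0
  | x :: w => (x : ℕ) + 1 + (d + 1) * wordCode w

variable {d : ℕ}

lemma wordCode_append (a b : List (Fin d)) :
    wordCode (a ++ b) = wordCode a + (d + 1) ^ a.length * wordCode b := by
  induction a with
  | nil => simp [wordCode]
  | cons x a ih =>
    simp only [List.cons_append, wordCode, ih, List.length_cons]
    ring

lemma wordCode_lt (w : List (Fin d)) : wordCode w < (d + 1) ^ w.length := by
  induction w with
  | nil => simp [wordCode]
  | cons x w ih =>
    have := x.2
    have := Nat.mul_le_mul_left (d + 1) ih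
    rw [Nat.mul_succ] at this
    simp only [wordCode, List.length_cons, pow_succ']
    omega

lemma pow_length_le_wordCode_cons (x : Fin d) (w : List (Fin d)) :
    (d + 1) ^ w.length ≤ wordCode (x :: w) := by
  induction w generalizing x with
  | nil => simp [wordCode]
  | cons y w ih =>
    have := Nat.mul_le_mul_left (d + 1) (ih y)
    rw [wordCode, List.length_cons, pow_succ']
    omega

lemma length_le_of_wordCode_le {u v : List (Fin d)} (h : wordCode u ≤ wordCode v) :
    u.length ≤ v.length := by
  by_contra! hlt
  cases u with
  | nil => simp at hlt
  | cons x u =>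
    have h1 := pow_length_le_wordCode_cons x u
    have h2 := wordCode_lt v
    have h3 : (d + 1) ^ v.length ≤ (d + 1) ^ u.length :=
      Nat.pow_le_pow_right (by omega) (by simpa using hlt)
    omega

lemma wordCode_injective : Function.Injective (wordCode (d := d)) := by
  intro u
  induction u with
  | nil =>
    intro v h
    cases v with
    | nil => rfl
    | cons y v =>
      simp only [wordCode] at h
      omega
  | cons x u ih =>
    intro v h
    cases v with
    | nil =>
      simp only [wordCode] at h
      omega
    | cons y v =>
      simp only [wordCode] at h
      have hx := x.2
      have hy := y.2
      have h1 := congrArg (· % (d + 1)) h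
      simp only [Nat.add_mul_mod_self_left] at h1
      rw [Nat.mod_eq_of_lt (by omega), Nat.mod_eq_of_lt (by omega)] at h1
      have hxy : x = y := Fin.ext (by omega)
      subst hxy
      rw [ih (Nat.eq_of_mul_eq_mul_left (show 0 < d + 1 by omega) (Nat.add_left_cancel h))]

/-- A larger code belongs to a word that is at least as long, so the digits of `b` are shifted at
least as far; the digits of `a` shift both codes alike. -/
lemma wordCode_append_lt {u v : List (Fin d)} (h : wordCode u < wordCode v) (a b : List (Fin d)) :
    wordCode (a ++ u ++ b) < wordCode (a ++ v ++ b) := by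
  simp only [wordCode_append, List.append_assoc]
  have h1 : (d + 1) ^ u.length ≤ (d + 1) ^ v.length :=
    Nat.pow_le_pow_right (by omega) (length_le_of_wordCode_le h.le)
  have h2 := Nat.mul_le_mul_right (wordCode b) h1
  exact Nat.add_lt_add_left (Nat.mul_lt_mul_of_pos_left (by omega) (by positivity)) _

end Code

/-! ### Normal words as a basis compatible with length. -/

section NormalWords

variable {k : Type u} [Field k] {B : Type v} [Ring B] [Algebra k B] {d : ℕ}

/-- The value of a word. -/
def evalWord {X : Type w} (e : X → B) (w : List X) : B := (w.map e).prod

lemma evalWord_append {X : Type w} (e : X → B) (a b : List X) :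
    evalWord e (a ++ b) = evalWord e a * evalWord e b := by
  simp [evalWord]

variable (k) in
/-- The words whose value is not a linear combination of values of smaller words. -/
def normalWords (e : Fin d → B) : Set (List (Fin d)) :=
  {w | evalWord e w ∉ Submodule.span k (evalWord e '' {v | wordCode v < wordCode w})}

/-- A reduction of a factor to smaller words, multiplied on both sides by the rest of the word, is a
reduction of the whole word. -/
lemma factorClosed_normalWords (e : Fin d → B) : FactorClosed (normalWords k e) := by
  rintro x u hx ⟨a, b, rfl⟩ hu
  apply hx
  rw [evalWord_append, evalWord_append]
  let T : B →ₗ[k] B := LinearMap.mulRight k (evalWord e b) ∘ₗ LinearMap.mulLeft k (evalWord e a)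
  have h := Submodule.mem_map_of_mem (f := T) hu
  rw [Submodule.map_span] at h
  refine Submodule.span_mono ?_ h
  rintro _ ⟨_, ⟨v, hv, rfl⟩, rfl⟩
  refine ⟨a ++ v ++ b, wordCode_append_lt hv a b, ?_⟩
  simp [T, evalWord_append, mul_assoc]

lemma nil_mem_normalWords [Nontrivial B] (e : Fin d → B) : [] ∈ normalWords k e := by
  simp [normalWords, wordCode, evalWord]

/-- Rewriting terminates because the code decreases, and it never lengthens a word because the code
compares lengths before letters. -/
lemma evalWord_mem_span_normalWords (e : Fin d → B) (w : List (Fin d)) :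
    evalWord e w ∈ Submodule.span k
      (evalWord e '' {v | v ∈ normalWords k e ∧ v.length ≤ w.length}) := by
  induction hc : wordCode w using Nat.strong_induction_on generalizing w with
  | _ c ih =>
  by_cases hw : w ∈ normalWords k e
  · exact Submodule.subset_span ⟨w, ⟨hw, le_rfl⟩, rfl⟩
  · simp only [normalWords, Set.mem_ofPred_eq, not_not] at hw
    refine Submodule.span_le.2 ?_ hw
    rintro _ ⟨v, hv, rfl⟩
    rw [Set.mem_ofPred_eq] at hv
    refine Submodule.span_mono (Set.image_mono ?_) (ih _ (hc ▸ hv) v rfl)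
    exact fun x hx => ⟨hx.1, hx.2.trans (length_le_of_wordCode_le hv.le)⟩

/-- In a nontrivial relation, the word with the largest code would be a combination of smaller ones.
-/
lemma linearIndepOn_normalWords (e : Fin d → B) :
    LinearIndepOn k (evalWord e) (normalWords k e) := by
  rw [linearIndepOn_iff_linearIndepOn_finset]
  intro s hs
  induction s using Finset.induction_on_max_value wordCode with
  | empty => simp
  | insert a s ha hmax ih =>
    rw [Finset.coe_insert] at hs ⊢
    refine (ih ((Set.subset_insert _ _).trans hs)).insert fun h => ?_
    refine hs (Set.mem_insert _ _) (Submodule.span_mono (Set.image_mono fun x hx => ?_) h)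
    refine lt_of_le_of_ne (hmax x hx) fun hxa => ha ?_
    rw [← wordCode_injective hxa]
    exact hx

variable (k) in
/-- The span of the values of the words of length at most `n`. -/
def wordSpan (e : Fin d → B) (n : ℕ) : Submodule k B :=
  Submodule.span k (evalWord e '' {w | w.length ≤ n})

lemma finite_wordSpan (e : Fin d → B) (n : ℕ) : Module.Finite k (wordSpan k e n) :=
  FiniteDimensional.span_of_finite k ((List.finite_length_le _ n).image _)

lemma finrank_wordSpan (e : Fin d → B) (n : ℕ) :
    Module.finrank k (wordSpan k e n) = wordCount (normalWords k e) n := by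
  have hfin := finite_words_length_le (normalWords k e) n
  have : Fintype {w : List (Fin d) | w ∈ normalWords k e ∧ w.length ≤ n} := hfin.fintype
  have hspan : wordSpan k e n = Submodule.span k
      (Set.range fun w : {w : List (Fin d) | w ∈ normalWords k e ∧ w.length ≤ n} =>
        evalWord e w.1) := by
    rw [← Set.image_eq_range]
    refine le_antisymm (Submodule.span_le.2 ?_) (Submodule.span_mono (Set.image_mono ?_))
    · rintro _ ⟨w, hw, rfl⟩
      refine Submodule.span_mono (Set.image_mono ?_) (evalWord_mem_span_normalWords e w)
      exact fun v hv => ⟨hv.1, hv.2.trans hw⟩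
    · exact fun x hx => hx.2
  have hli : LinearIndepOn k (evalWord e)
      {w : List (Fin d) | w ∈ normalWords k e ∧ w.length ≤ n} :=
    (linearIndepOn_normalWords e).mono (Set.sep_subset _ _)
  rw [hspan, finrank_span_eq_card hli, wordCount, ← Nat.card_coe_set_eq,
    Nat.card_eq_fintype_card]

end NormalWords

/-! ### From algebras to languages, by adjoining a unit. -/

section Algebras

variable {k : Type u} [Field k] {A : Type v} [NonUnitalRing A] [Module k A] [IsScalarTower k A A]
  [SMulCommClass k A A]

lemma exists_evalWord_eq_inr {V : Submodule k A} {d : ℕ} {b : Fin d → A} (hb : ∀ i, b i ∈ V)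
    {w : List (Fin d)} (hw : w ≠ []) :
    ∃ a ∈ powSet (V : Set A) w.length,
      evalWord (fun i => (Unitization.inr (b i) : Unitization k A)) w = Unitization.inr a := by
  induction w using List.reverseRecOn with
  | nil => exact absurd rfl hw
  | append_singleton w x ih =>
    rcases List.eq_nil_or_concat w with rfl | ⟨w', y, rfl⟩
    · exact ⟨b x, hb x, by simp [evalWord]⟩
    · obtain ⟨a, ha, h⟩ := ih (by simp)
      refine ⟨a * b x, ?_, ?_⟩
      · simp only [List.length_append, List.length_singleton, List.concat_eq_append] at ha ⊢
        exact ⟨a, ha, b x, hb x, rfl⟩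
      · rw [evalWord_append, h]
        simp [evalWord]

lemma inr_mem_span_evalWord {V : Submodule k A} {d : ℕ} {b : Fin d → A}
    (hb : V ≤ Submodule.span k (Set.range b)) {m : ℕ} {a : A} (ha : a ∈ powSet (V : Set A) m) :
    (Unitization.inr a : Unitization k A) ∈ Submodule.span k
      (evalWord (fun i => (Unitization.inr (b i) : Unitization k A)) '' {w | w.length = m}) := by
  have hone : ∀ x ∈ V, (Unitization.inr x : Unitization k A) ∈ Submodule.span k
      (evalWord (fun i => (Unitization.inr (b i) : Unitization k A)) '' {w | w.length = 1}) := by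
    intro x hx
    have h := Submodule.mem_map_of_mem (f := Unitization.inrHom k k A) (hb hx)
    rw [Submodule.map_span] at h
    refine Submodule.span_mono ?_ h
    rintro _ ⟨_, ⟨i, rfl⟩, rfl⟩
    exact ⟨[i], rfl, by simp [evalWord]⟩
  match m with
  | 0 => exact absurd ha (Set.notMem_empty a)
  | 1 => exact hone a ha
  | m + 2 =>
    obtain ⟨y, hy, x, hx, rfl⟩ := ha
    have h := Submodule.mul_mem_mul (inr_mem_span_evalWord hb hy) (hone x hx)
    rw [Submodule.span_mul_span] at h
    rw [Unitization.inr_mul]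
    refine Submodule.span_mono ?_ h
    rintro _ ⟨_, ⟨v, hv, rfl⟩, _, ⟨w, hw, rfl⟩, rfl⟩
    refine ⟨v ++ w, ?_, evalWord_append _ _ _⟩
    rw [Set.mem_ofPred_eq] at hv hw ⊢
    rw [List.length_append, hv, hw]

/-- The words span the direct sum of the line through 1 and the copy of the span of products of
length 1 to `n`; the extra dimension is the empty word. -/
lemma finrank_wordSpan_inr {V : Submodule k A} {d : ℕ} {b : Fin d → A}
    (hb : V = Submodule.span k (Set.range b)) (n : ℕ) :
    Module.finrank k (wordSpan k (fun i => (Unitization.inr (b i) : Unitization k A)) n) =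
      algebraGrowth V n + 1 := by
  set e : Fin d → Unitization k A := fun i => Unitization.inr (b i)
  set Q := Submodule.span k (ball (V : Set A) n)
  have hfin := finite_wordSpan (k := k) e n
  let ι : A →ₗ[k] Unitization k A := Unitization.inrHom k k A
  have hι : Function.Injective ι := Unitization.inr_injective
  have hsup : wordSpan k e n = Submodule.span k {1} ⊔ Q.map ι := by
    apply le_antisymm
    · refine Submodule.span_le.2 ?_
      rintro _ ⟨w, hw, rfl⟩
      by_cases hnil : w = []
      · subst hnil
        exact Submodule.mem_sup_left (Submodule.subset_span (by simp [evalWord]))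
      · obtain ⟨a, ha, h⟩ := exists_evalWord_eq_inr (k := k) (V := V) (b := b)
          (fun i => hb ▸ Submodule.subset_span ⟨i, rfl⟩) hnil
        rw [SetLike.mem_coe, h]
        exact Submodule.mem_sup_right (Submodule.mem_map_of_mem (Submodule.subset_span
          ⟨w.length, List.length_pos_iff.2 hnil, hw, ha⟩))
    · refine sup_le (Submodule.span_le.2 ?_) ?_
      · rintro _ rfl
        exact Submodule.subset_span ⟨[], by simp, by simp [evalWord]⟩
      · rw [Submodule.map_span, Submodule.span_le]
        rintro _ ⟨a, ⟨m, _, hm, ha⟩, rfl⟩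
        refine Submodule.span_mono (Set.image_mono ?_) (inr_mem_span_evalWord hb.le ha)
        rintro w rfl
        exact hm
  have hfin' : Module.Finite k (Q.map ι) :=
    Submodule.finiteDimensional_of_le (hsup ▸ le_sup_right : Q.map ι ≤ wordSpan k e n)
  have hinf : Submodule.span k {1} ⊓ Q.map ι = ⊥ := by
    rw [eq_bot_iff]
    rintro x ⟨hx, y, _, rfl⟩
    obtain ⟨c, hc⟩ := Submodule.mem_span_singleton.1 hx
    have h := congrArg (fun x => x.fst) hc
    simp [ι] at h
    rw [h, zero_smul] at hc
    rw [← hc]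
    exact Submodule.zero_mem _
  have h := Submodule.finrank_sup_add_finrank_inf_eq (Submodule.span k {(1 : Unitization k A)})
    (Q.map ι)
  rw [hinf, finrank_bot, add_zero, finrank_span_singleton one_ne_zero,
    ← LinearEquiv.finrank_eq (Submodule.equivMapOfInjective ι hι Q)] at h
  rw [hsup, h, add_comm]
  rfl

lemma one_le_algebraGrowth_one [Nontrivial A] {V : Submodule k A} [Module.Finite k V]
    (hV : NonUnitalAlgebra.adjoin k (V : Set A) = ⊤) : 1 ≤ algebraGrowth V 1 := by
  have hball : ball (V : Set A) 1 = V := by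
    ext x
    constructor
    · rintro ⟨m, h1, h2, h⟩
      obtain rfl : m = 1 := by omega
      exact h
    · exact fun h => ⟨1, le_rfl, le_rfl, h⟩
  rw [algebraGrowth, hball, Submodule.span_eq, Nat.one_le_iff_ne_zero, ne_eq,
    Submodule.finrank_eq_zero]
  rintro rfl
  obtain ⟨x, hx⟩ := exists_ne (0 : A)
  have h : NonUnitalAlgebra.adjoin k ((⊥ : Submodule k A) : Set A) ≤ ⊥ :=
    NonUnitalAlgebra.adjoin_le (by simp)
  rw [hV] at h
  exact hx (NonUnitalAlgebra.mem_bot.1 (h NonUnitalAlgebra.mem_top))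

/-- The growth function of a finitely generated algebra is equivalent to an admissible
function. -/
theorem IsAlgebraGrowth.exists_admissible {f : ℕ → ℕ} (hf : IsAlgebraGrowth.{u, v} k f) :
    ∃ F, IsAdmissible F ∧ AsympEquiv f F := by
  obtain ⟨A, _, _, _, _, _, V, hV, hgen, rfl⟩ := hf
  let b := Module.finBasis k V
  have hb : V = Submodule.span k (Set.range fun i => (b i : A)) := by
    have h := congrArg (Submodule.map V.subtype) b.span_eq
    rw [Submodule.map_span, Submodule.map_top, Submodule.range_subtype, ← Set.range_comp] at h
    exact h.symm
  refine exists_admissible_of_wordCount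
    (factorClosed_normalWords (fun i => (Unitization.inr (b i : A) : Unitization k A)))
    (nil_mem_normalWords (k := k) _) (fun n => ?_) (one_le_algebraGrowth_one hgen)
  rw [← finrank_wordSpan, finrank_wordSpan_inr hb]

end Algebras

/-! ### Dyadic increments of gap functions and the block sizes. -/

section Numeric

variable {F : ℕ → ℕ}

lemma IsGapFun.add_le_succ (hF : IsGapFun F) (n : ℕ) : F n + (n + 2) ≤ F (n + 1) := by
  have := hF.2.1 (n + 1)
  simp only [discreteDeriv] at this
  push_cast at this
  omega

/-- Each increment beyond `a` exceeds `a`. This is the quadratic growth that absorbs the errors in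
`IsGapFun.exists_language`. -/
lemma IsGapFun.add_mul_le (hF : IsGapFun F) (a b : ℕ) : F a + b * a ≤ F (a + b) := by
  induction b with
  | zero => simp
  | succ b ih =>
    have := hF.add_le_succ (a + b)
    rw [← add_assoc, Nat.succ_mul]
    omega

lemma IsGapFun.one_le_zero (hF : IsGapFun F) : 1 ≤ F 0 := by
  have := hF.2.1 0
  simp only [discreteDeriv] at this
  push_cast at this
  omega

lemma IsGapFun.sub_le_sq (hF : IsGapFun F) {n m : ℕ} (h1 : n ≤ m) (h2 : m ≤ 2 * n + 1) :
    F (m + 1) - F m ≤ (F (n + 1) - F n) ^ 2 := by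
  have := hF.2.2 (n + 1) (m + 1) (by omega) (by omega) (by omega)
  simp only [discreteDeriv] at this
  zify
  rw [Nat.cast_sub (hF.1 (by omega)), Nat.cast_sub (hF.1 (by omega))]
  exact this

/-- The increments at 2m + 1 and 2m + 2 are both at most the square of the increment at m + 1, and a
sum of squares is at most the square of the sum. -/
lemma IsGapFun.double_le (hF : IsGapFun F) (n j : ℕ) :
    F (2 * n + 2 * j) ≤ F (2 * n) + 2 * (F (n + j) - F n) ^ 2 := by
  induction j with
  | zero => simp
  | succ j ih =>
    have h1 := hF.sub_le_sq (n := n + j) (m := 2 * n + 2 * j) (by omega) (by omega)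
    have h2 := hF.sub_le_sq (n := n + j) (m := 2 * n + 2 * j + 1) (by omega) (by omega)
    have h3 : F (n + (j + 1)) - F n = (F (n + j) - F n) + (F (n + j + 1) - F (n + j)) := by
      have := hF.1 (show n ≤ n + j by omega)
      have := hF.1 (show n + j ≤ n + j + 1 by omega)
      rw [← add_assoc]
      omega
    rw [h3, show 2 * n + 2 * (j + 1) = 2 * n + 2 * j + 1 + 1 by ring]
    set A := F (n + j) - F n
    set B := F (n + j + 1) - F (n + j)
    have h4 : A ^ 2 + B ^ 2 ≤ (A + B) ^ 2 := by nlinarith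
    omega

/-- The increments of `F` over dyadic intervals. -/
def dyadicStep (F : ℕ → ℕ) : ℕ → ℕ
  | 0 => F 2
  | k + 1 => F (2 ^ (k + 2)) - F (2 ^ (k + 1))

lemma IsGapFun.dyadicStep_succ_le (hF : IsGapFun F) (k : ℕ) :
    dyadicStep F (k + 1) ≤ 2 * dyadicStep F k ^ 2 := by
  have h := hF.double_le (2 ^ k) (2 ^ k)
  have h1 : F (2 ^ k + 2 ^ k) - F (2 ^ k) ≤ dyadicStep F k := by
    cases k with
    | zero => exact Nat.sub_le _ _
    | succ k =>
      rw [← two_mul, ← pow_succ', dyadicStep]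
  have h2 := Nat.pow_le_pow_left h1 2
  rw [dyadicStep, show 2 ^ (k + 2) = 2 * 2 ^ k + 2 * 2 ^ k by ring,
    show 2 ^ (k + 1) = 2 * 2 ^ k by ring]
  omega

lemma IsGapFun.dyadicStep_pos (hF : IsGapFun F) (k : ℕ) : 1 ≤ dyadicStep F k := by
  cases k with
  | zero => exact hF.one_le_zero.trans (hF.1 (Nat.zero_le _))
  | succ k =>
    have := hF.add_mul_le (2 ^ (k + 1)) (2 ^ (k + 1))
    rw [← two_mul (2 ^ (k + 1)), ← pow_succ'] at this
    have : 0 < 2 ^ (k + 1) * 2 ^ (k + 1) := by positivity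
    rw [dyadicStep, show k + 2 = k + 1 + 1 from rfl]
    omega

/-- Take the least `u k` whose fifth power reaches twice the increment. Minimality and u ≤ 2(u - 1)
cost at most 2⁵. The factor 2 is what closes the recursion: (u²)⁵ ≥ (2S)² = 2 · 2S². -/
lemma IsGapFun.exists_block_numbers (hF : IsGapFun F) : ∃ u : ℕ → ℕ, ∀ k,
    2 * dyadicStep F k ≤ u k ^ 5 ∧ u k ^ 5 ≤ 64 * dyadicStep F k ∧ u (k + 1) ≤ u k ^ 2 ∧
      2 ≤ u k := by
  have hex : ∀ k, ∃ u, 2 * dyadicStep F k ≤ u ^ 5 := fun k =>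
    ⟨2 * dyadicStep F k, Nat.le_self_pow (by norm_num) _⟩
  classical
  refine ⟨fun k => Nat.find (hex k), fun k => ?_⟩
  have hspec := Nat.find_spec (hex k)
  have hpos := hF.dyadicStep_pos k
  have h2 : 2 ≤ Nat.find (hex k) := by
    by_contra h
    have : Nat.find (hex k) ^ 5 ≤ 1 ^ 5 := Nat.pow_le_pow_left (by omega) 5
    omega
  refine ⟨hspec, ?_, ?_, h2⟩
  · have hlt := Nat.find_min (hex k) (m := Nat.find (hex k) - 1) (by omega)
    have : Nat.find (hex k) ^ 5 ≤ (2 * (Nat.find (hex k) - 1)) ^ 5 :=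
      Nat.pow_le_pow_left (by omega) 5
    rw [mul_pow] at this
    change Nat.find (hex k) ^ 5 ≤ _
    omega
  · apply Nat.find_min'
    have := hF.dyadicStep_succ_le k
    have := Nat.pow_le_pow_left hspec 2
    rw [← pow_mul, mul_comm 2 5, pow_mul]
    nlinarith

end Numeric

/-! ### Factors of words and products of blocks. -/

section Factors

variable {X : Type w}

open Classical in
/-- The finite set of factors of a word. -/
noncomputable def factors (y : List X) : Finset (List X) :=
  (Finset.range (y.length + 1) ×ˢ Finset.range (y.length + 1)).image
    fun q => (y.drop q.1).take q.2

lemma mem_factors {x y : List X} : x ∈ factors y ↔ x <:+: y := by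
  classical
  simp only [factors, Finset.mem_image, Finset.mem_product, Finset.mem_range, Prod.exists]
  constructor
  · rintro ⟨a, b, _, rfl⟩
    exact (List.take_prefix _ _).isInfix.trans (List.drop_suffix _ _).isInfix
  · rintro ⟨s, t, rfl⟩
    refine ⟨s.length, x.length, ?_, ?_⟩
    · simp
      omega
    · simp

lemma card_factors_le (y : List X) : (factors y).card ≤ (y.length + 1) ^ 2 := by
  classical
  refine Finset.card_image_le.trans ?_
  simp [sq]

open Classical in
/-- Adding words one by one together with their factors, the number of words can be tuned up to
a quadratic error. -/
lemma exists_subset_card_union_factors (E P : Finset (List X)) {m T : ℕ}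
    (hP : ∀ y ∈ P, y.length = m) (hT : T ≤ (E ∪ P.biUnion factors).card) :
    ∃ D ⊆ P, T ≤ (E ∪ D.biUnion factors).card ∧
      (E ∪ D.biUnion factors).card ≤ max E.card (T + (m + 1) ^ 2) := by
  induction P using Finset.induction_on with
  | empty => exact ⟨∅, le_rfl, hT, by simp⟩
  | insert a P _ ih =>
    by_cases h : T ≤ (E ∪ P.biUnion factors).card
    · obtain ⟨D, hD, h1, h2⟩ := ih (fun y hy => hP y (Finset.mem_insert_of_mem hy)) h
      exact ⟨D, hD.trans (Finset.subset_insert _ _), h1, h2⟩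
    -- The set is still below `T` without `a`, so adding `a` overshoots by at most the number of its
    -- factors.
    · refine ⟨_, le_rfl, hT, le_max_of_le_right ?_⟩
      rw [Finset.biUnion_insert, Finset.union_comm (factors a), ← Finset.union_assoc]
      have h1 := card_factors_le a
      rw [hP a (Finset.mem_insert_self _ _)] at h1
      have h2 := Finset.card_union_le (E ∪ P.biUnion factors) (factors a)
      omega

open Classical in
/-- The set of products of `n` words from `U`. -/
noncomputable def prodPow (U : Finset (List X)) : ℕ → Finset (List X)
  | 0 => {[]}
  | n + 1 => Finset.image₂ (fun x y => x ++ y) U (prodPow U n)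

lemma length_of_mem_prodPow {U : Finset (List X)} {N : ℕ} (hU : ∀ x ∈ U, x.length = N) {n : ℕ}
    {x : List X} (hx : x ∈ prodPow U n) : x.length = n * N := by
  induction n generalizing x with
  | zero => simp_all [prodPow]
  | succ n ih =>
    classical
    simp only [prodPow, Finset.mem_image₂] at hx
    obtain ⟨a, ha, b, hb, rfl⟩ := hx
    rw [List.length_append, hU a ha, ih hb]
    ring

lemma card_prodPow {U : Finset (List X)} {N : ℕ} (hU : ∀ x ∈ U, x.length = N) (n : ℕ) :
    (prodPow U n).card = U.card ^ n := by
  classical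
  induction n with
  | zero => simp [prodPow]
  | succ n ih =>
    rw [prodPow, Finset.card_image₂_iff.2, ih, pow_succ']
    rintro ⟨a, b⟩ h ⟨a', b'⟩ h' hab
    simp only [Set.mem_prod, Finset.mem_coe] at h h'
    obtain ⟨h1, h2⟩ := List.append_inj hab (by rw [hU a h.1, hU a' h'.1])
    exact Prod.ext h1 h2

/-- Words that are products of elements of `U`. -/
def IsProd (U : Finset (List X)) (x : List X) : Prop :=
  ∃ l : List (List X), (∀ y ∈ l, y ∈ U) ∧ l.flatten = x

lemma isProd_of_mem_prodPow {U : Finset (List X)} {n : ℕ} {x : List X} (hx : x ∈ prodPow U n) :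
    IsProd U x := by
  classical
  induction n generalizing x with
  | zero => exact ⟨[], by simp, by simp_all [prodPow]⟩
  | succ n ih =>
    simp only [prodPow, Finset.mem_image₂] at hx
    obtain ⟨a, ha, b, hb, rfl⟩ := hx
    obtain ⟨l, hl, rfl⟩ := ih hb
    exact ⟨a :: l, by simpa using ⟨ha, hl⟩, by simp⟩

open Classical in
lemma IsProd.of_subset {U V : Finset (List X)}
    (hV : V ⊆ Finset.image₂ (fun x y => x ++ y) U U) {x : List X} (hx : IsProd V x) :
    IsProd U x := by
  obtain ⟨l, hl, rfl⟩ := hx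
  induction l with
  | nil => exact ⟨[], by simp, rfl⟩
  | cons a l ih =>
    simp only [List.mem_cons, forall_eq_or_imp] at hl
    obtain ⟨l', hl', h⟩ := ih hl.2
    obtain ⟨b, hb, c, hc, rfl⟩ := Finset.mem_image₂.1 (hV hl.1)
    exact ⟨b :: c :: l', by simpa using ⟨hb, hc, hl'⟩, by simp [h]⟩

/-- A short factor of a product of words of equal length is a factor of a product of two of
them. -/
lemma exists_infix_append {U : Finset (List X)} {N : ℕ} (hU : ∀ x ∈ U, x.length = N)
    (hne : U.Nonempty) {x y : List X} (hy : IsProd U y) (hxy : x <:+: y) (hx : x.length ≤ N) :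
    ∃ a ∈ U, ∃ b ∈ U, x <:+: a ++ b := by
  obtain ⟨l, hl, rfl⟩ := hy
  obtain ⟨c, hc⟩ := hne
  induction l with
  | nil =>
    rw [List.flatten_nil, List.infix_nil] at hxy
    subst hxy
    exact ⟨c, hc, c, hc, List.nil_infix⟩
  | cons a l ih =>
    simp only [List.mem_cons, forall_eq_or_imp] at hl
    rw [List.flatten_cons, List.infix_append_iff] at hxy
    rcases hxy with h | h | ⟨s, t, rfl, hs, ht⟩
    · exact ⟨a, hl.1, c, hc, List.infix_append_of_infix_left h⟩
    · exact ih hl.2 h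
    · cases l with
      | nil =>
        rw [List.flatten_nil, List.prefix_nil] at ht
        subst ht
        refine ⟨a, hl.1, c, hc, List.infix_append_of_infix_left ?_⟩
        simpa using hs.isInfix
      | cons b l =>
        have hb : b ∈ U := hl.2 b (by simp)
        refine ⟨a, hl.1, b, hb, ?_⟩
        rw [List.infix_append_iff]
        refine Or.inr (Or.inr ⟨s, t, rfl, hs, ?_⟩)
        refine List.prefix_of_prefix_length_le ht (by simp) ?_
        rw [hU b hb]
        simp at hx
        omega

end Factors

/-! ### Words with at most one exceptional letter. -/

section Sparse

variable {X : Type w}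

/-- Factors of the words `z ⋯ z o z ⋯ z`. -/
def IsSparse (z o : X) (x : List X) : Prop :=
  ∃ a b, x <:+: List.replicate a z ++ o :: List.replicate b z

lemma IsSparse.eq {z o : X} {x : List X} (h : IsSparse z o x) :
    (∃ a, x = List.replicate a z) ∨
      ∃ a b, x = List.replicate a z ++ o :: List.replicate b z := by
  obtain ⟨a, b, h⟩ := h
  have key : ∀ t, t <+: o :: List.replicate b z → t = [] ∨ ∃ c, t = o :: List.replicate c z := by
    intro t ht
    rcases List.prefix_cons_iff.1 ht with h | ⟨s, rfl, hs⟩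
    · exact Or.inl h
    · rw [List.prefix_replicate_iff] at hs
      exact Or.inr ⟨s.length, by rw [← hs.2]⟩
  rw [List.infix_append_iff] at h
  rcases h with h | h | ⟨s, t, rfl, hs, ht⟩
  · rw [List.infix_replicate_iff] at h
    exact Or.inl ⟨_, h.2⟩
  · rcases List.infix_cons_iff.1 h with h | h
    · rcases key _ h with h | ⟨c, h⟩
      · exact Or.inl ⟨0, h⟩
      · exact Or.inr ⟨0, c, h⟩
    · rw [List.infix_replicate_iff] at h
      exact Or.inl ⟨_, h.2⟩
  · rw [List.suffix_replicate_iff] at hs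
    rcases key _ ht with rfl | ⟨c, rfl⟩
    · exact Or.inl ⟨s.length, by simpa using hs.2⟩
    · exact Or.inr ⟨s.length, c, by rw [← hs.2]⟩

lemma ncard_sparse_le (z o : X) (m : ℕ) :
    {x : List X | IsSparse z o x ∧ x.length ≤ m}.Finite ∧
    {x : List X | IsSparse z o x ∧ x.length ≤ m}.ncard ≤ 2 * (m + 1) ^ 2 := by
  classical
  let A : Finset (List X) := (Finset.range (m + 1)).image fun a => List.replicate a z
  let B : Finset (List X) := (Finset.range (m + 1) ×ˢ Finset.range (m + 1)).image
    fun q => List.replicate q.1 z ++ o :: List.replicate q.2 z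
  have hsub : {x : List X | IsSparse z o x ∧ x.length ≤ m} ⊆ ↑(A ∪ B) := by
    rintro x ⟨hx, hxm⟩
    rw [Finset.coe_union]
    rcases hx.eq with ⟨a, rfl⟩ | ⟨a, b, rfl⟩
    · left
      simp only [A, Finset.coe_image, Set.mem_image, Finset.mem_coe, Finset.mem_range]
      exact ⟨a, by simp at hxm; omega, rfl⟩
    · right
      simp only [B, Finset.coe_image, Set.mem_image, Finset.mem_coe, Finset.mem_product,
        Finset.mem_range]
      exact ⟨(a, b), by simp at hxm; constructor <;> simp <;> omega, rfl⟩
  refine ⟨(A ∪ B).finite_toSet.subset hsub,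
    (Set.ncard_le_ncard hsub (A ∪ B).finite_toSet).trans ?_⟩
  rw [Set.ncard_coe_finset]
  have hA : A.card ≤ m + 1 := Finset.card_image_le.trans (by simp)
  have hB : B.card ≤ (m + 1) ^ 2 := Finset.card_image_le.trans (by simp [sq])
  have := Finset.card_union_le A B
  nlinarith

open Classical in
/-- The words of length `4 M` with all letters equal to `z`, except for one letter `o` not too
close to the ends. -/
noncomputable def sparseBlocks (z o : X) (M : ℕ) : Finset (List X) :=
  (Finset.Ico M (3 * M)).image fun i => List.replicate i z ++ o :: List.replicate (4 * M - 1 - i) z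

lemma length_of_mem_sparseBlocks {z o : X} {M : ℕ} {x : List X} (hx : x ∈ sparseBlocks z o M) :
    x.length = 4 * M := by
  classical
  simp only [sparseBlocks, Finset.mem_image, Finset.mem_Ico] at hx
  obtain ⟨i, hi, rfl⟩ := hx
  simp
  omega

lemma card_sparseBlocks {z o : X} (hzo : z ≠ o) (M : ℕ) : (sparseBlocks z o M).card = 2 * M := by
  classical
  rw [sparseBlocks, Finset.card_image_of_injective]
  · simp
    omega
  · have key : ∀ i b, (List.replicate i z ++ o :: List.replicate b z).idxOf o = i := by
      intro i b
      rw [List.idxOf_append_of_notMem]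
      · simp
      · simp [hzo.symm]
    intro i j hij
    have := congrArg (List.idxOf o) hij
    rwa [key, key] at this

/-- At least `M` letters `z` follow the `o` of the first block and at least `M` precede that of the
second, so a factor of length at most 2M cannot contain both. -/
lemma isSparse_of_infix_append {z o : X} {M : ℕ} {x a b : List X} (ha : a ∈ sparseBlocks z o M)
    (hb : b ∈ sparseBlocks z o M) (hx : x <:+: a ++ b) (hxM : x.length ≤ 2 * M) :
    IsSparse z o x := by
  classical
  simp only [sparseBlocks, Finset.mem_image, Finset.mem_Ico] at ha hb
  obtain ⟨i, hi, rfl⟩ := ha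
  obtain ⟨j, hj, rfl⟩ := hb
  have e : List.replicate i z ++ o :: List.replicate (4 * M - 1 - i) z ++
      (List.replicate j z ++ o :: List.replicate (4 * M - 1 - j) z) =
      (List.replicate i z ++ o :: List.replicate (4 * M - 1 - i + j) z) ++
      (o :: List.replicate (4 * M - 1 - j) z) := by
    rw [List.replicate_add (4 * M - 1 - i) j z]
    simp only [List.append_assoc, List.cons_append]
  rw [e, List.infix_append_iff] at hx
  rcases hx with h | h | ⟨s, t, rfl, hs, ht⟩
  · exact ⟨_, _, h⟩
  · exact ⟨0, _, by simpa using h⟩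
  · refine ⟨4 * M - 1 - i + j, 4 * M - 1 - j, ?_⟩
    rw [List.infix_append_iff]
    rcases Nat.lt_or_ge (4 * M - 1 - i + j) s.length with h | h
    · refine Or.inr (Or.inl ?_)
      simp at hxM
      omega
    · refine Or.inr (Or.inr ⟨s, t, rfl, ?_, ht⟩)
      refine List.suffix_of_suffix_length_le hs ?_ (by simpa using h)
      exact (List.suffix_cons _ _).trans (List.suffix_append _ _)

end Sparse

/-! ### The recursive choice of blocks of length 2^k. -/

section Blocks

variable {X : Type w}

open Classical in
/-- `V` consists of sparse words of length `N`, or it is a set of exactly `c` products of two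
elements of `U`. -/
def IsNextBlock (z o : X) (N c : ℕ) (U V : Finset (List X)) : Prop :=
  (∃ M, N = 4 * M ∧ V = sparseBlocks z o M) ∨
    (V.card = c ∧ N < 2 * c ∧ V ⊆ Finset.image₂ (fun x y => x ++ y) U U)

/-- If `c'` is at most half the new length, the sparse blocks suffice, since their number is half
their length. Otherwise `c'` words are selected from the at least c² products of two blocks. -/
lemma exists_next_block {z o : X} (hzo : z ≠ o) {k c c' : ℕ} (hc' : 2 ≤ c') (hcc : c' ≤ c ^ 2)
    {U : Finset (List X)} (hU : ∀ x ∈ U, x.length = 2 ^ k) (hcard : c ≤ U.card) :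
    ∃ V : Finset (List X), ((∀ x ∈ V, x.length = 2 ^ (k + 1)) ∧ c' ≤ V.card) ∧
      IsNextBlock z o (2 ^ (k + 1)) c' U V := by
  classical
  by_cases hlow : c' ≤ 2 ^ k
  · cases k with
    | zero => simp at hlow; omega
    | succ l =>
      have e : 2 ^ (l + 1 + 1) = 4 * 2 ^ l := by ring
      refine ⟨sparseBlocks z o (2 ^ l), ⟨fun x hx => ?_, ?_⟩, Or.inl ⟨2 ^ l, e, rfl⟩⟩
      · rw [length_of_mem_sparseBlocks hx, e]
      · rw [card_sparseBlocks hzo, ← pow_succ']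
        exact hlow
  · have h2 : c' ≤ (Finset.image₂ (fun x y => x ++ y) U U).card := by
      rw [Finset.card_image₂_iff.2]
      · nlinarith
      · rintro ⟨a, b⟩ h ⟨a', b'⟩ h' hab
        simp only [Set.mem_prod, Finset.mem_coe] at h h'
        obtain ⟨h1, h2⟩ := List.append_inj hab (by rw [hU a h.1, hU a' h'.1])
        exact Prod.ext h1 h2
    obtain ⟨V, hV, hVc⟩ := Finset.exists_subset_card_eq h2
    refine ⟨V, ⟨fun x hx => ?_, hVc.ge⟩, Or.inr ⟨hVc, ?_, hV⟩⟩
    · obtain ⟨a, ha, b, hb, rfl⟩ := Finset.mem_image₂.1 (hV hx)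
      rw [List.length_append, hU a ha, hU b hb]
      ring
    · rw [pow_succ]
      omega

lemma exists_blocks [Fintype X] {z o : X} (hzo : z ≠ o) {c : ℕ → ℕ} (hc : ∀ k, 2 ≤ c k)
    (hcc : ∀ k, c (k + 1) ≤ c k ^ 2) (hX : c 0 ≤ Fintype.card X) :
    ∃ U : ℕ → Finset (List X), (∀ k, (∀ x ∈ U k, x.length = 2 ^ k) ∧ c k ≤ (U k).card) ∧
      ∀ k, IsNextBlock z o (2 ^ (k + 1)) (c (k + 1)) (U k) (U (k + 1)) := by
  classical
  let Q : ℕ → Type w := fun k =>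
    {U : Finset (List X) // (∀ x ∈ U, x.length = 2 ^ k) ∧ c k ≤ U.card}
  have h0 : ∃ U : Finset (List X), (∀ x ∈ U, x.length = 2 ^ 0) ∧ c 0 ≤ U.card := by
    refine ⟨Finset.univ.image fun x : X => [x], by simp, ?_⟩
    rw [Finset.card_image_of_injective _ fun a b h => by simpa using h]
    exact hX
  have hstep : ∀ k (U : Q k), ∃ V : Q (k + 1),
      IsNextBlock z o (2 ^ (k + 1)) (c (k + 1)) U.1 V.1 := by
    intro k U
    obtain ⟨V, hV, h⟩ := exists_next_block hzo (hc (k + 1)) (hcc k) U.2.1 U.2.2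
    exact ⟨⟨V, hV⟩, h⟩
  choose g hg using hstep
  let s : ∀ k, Q k := fun k => Nat.rec ⟨h0.choose, h0.choose_spec⟩ g k
  exact ⟨fun k => (s k).1, fun k => (s k).2, fun k => hg k (s k)⟩

variable {z o : X} {c : ℕ → ℕ} {U : ℕ → Finset (List X)}

/-- Short factors of products of blocks are sparse or factors of products of two blocks of a
fixed smaller level. -/
lemma infix_append_or_isSparse (hU : ∀ k, ∀ x ∈ U k, x.length = 2 ^ k)
    (hne : ∀ k, (U k).Nonempty)
    (hnext : ∀ k, IsNextBlock z o (2 ^ (k + 1)) (c (k + 1)) (U k) (U (k + 1)))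
    {k j : ℕ} (hkj : k + 1 ≤ j) {x y : List X} (hy : IsProd (U j) y) (hxy : x <:+: y)
    (hx : x.length ≤ 2 ^ k) :
    (∃ a ∈ U (k + 1), ∃ b ∈ U (k + 1), x <:+: a ++ b) ∨ IsSparse z o x := by
  have hle : ∀ i, k ≤ i → x.length ≤ 2 ^ i := fun i hi =>
    hx.trans (Nat.pow_le_pow_right (by norm_num) hi)
  induction j, hkj using Nat.le_induction with
  | base => exact Or.inl (exists_infix_append (hU _) (hne _) hy hxy (hle _ (by omega)))
  | succ j hj ih =>
    -- Selected products are again products of blocks one level lower, so one descends; a sparse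
    -- level stops the descent, since its short factors are sparse.
    rcases hnext j with ⟨M, hM, hUj⟩ | ⟨_, _, hsub⟩
    · right
      obtain ⟨a, ha, b, hb, h⟩ :=
        exists_infix_append (hU _) (hne _) hy hxy (hle _ (by omega))
      rw [hUj] at ha hb
      refine isSparse_of_infix_append ha hb h ((hle j (by omega)).trans ?_)
      rw [pow_succ] at hM
      omega
    · exact ih (hy.of_subset hsub)

/-- In the selected case the 2^(k+1) letters of a block number less than 2n, with n = `c (k + 1)`,
so the factors of products of two blocks number at most n² (4n)² = 16 n⁴, to be compared with n⁵ ≤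
64 S. -/
lemma ncard_short_le (hU : ∀ k, ∀ x ∈ U k, x.length = 2 ^ k)
    (hnext : ∀ k, IsNextBlock z o (2 ^ (k + 1)) (c (k + 1)) (U k) (U (k + 1))) {k S : ℕ}
    (hS : c (k + 1) ^ 5 ≤ 64 * S) :
    ∃ G : Finset (List X), (∀ x : List X, x.length ≤ 2 ^ k →
      ((∃ a ∈ U (k + 1), ∃ b ∈ U (k + 1), x <:+: a ++ b) ∨ IsSparse z o x) → x ∈ G) ∧
      G.card ≤ 2 * (2 ^ k + 1) ^ 2 + S + 2 ^ 44 := by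
  classical
  obtain ⟨hfin, hcard⟩ := ncard_sparse_le z o (2 ^ k)
  rw [Set.ncard_eq_toFinset_card _ hfin] at hcard
  rcases hnext k with ⟨M, hM, hUk⟩ | ⟨hcU, hlt, _⟩
  · refine ⟨hfin.toFinset, fun x hx h => ?_, by omega⟩
    rw [Set.Finite.mem_toFinset]
    refine ⟨?_, hx⟩
    rcases h with ⟨a, ha, b, hb, h⟩ | h
    · rw [hUk] at ha hb
      refine isSparse_of_infix_append ha hb h (hx.trans ?_)
      rw [pow_succ] at hM
      omega
    · exact h
  · refine ⟨hfin.toFinset ∪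
      (Finset.image₂ (fun x y => x ++ y) (U (k + 1)) (U (k + 1))).biUnion factors,
      fun x hx h => ?_, ?_⟩
    · rw [Finset.mem_union]
      rcases h with ⟨a, ha, b, hb, h⟩ | h
      · right
        rw [Finset.mem_biUnion]
        exact ⟨a ++ b, Finset.mem_image₂_of_mem ha hb, mem_factors.2 h⟩
      · left
        rw [Set.Finite.mem_toFinset]
        exact ⟨h, hx⟩
    · set n := c (k + 1) with hn
      have h1 : ((Finset.image₂ (fun x y => x ++ y) (U (k + 1)) (U (k + 1))).biUnion
          factors).card ≤ n * n * (4 * n) ^ 2 := by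
        refine (Finset.card_biUnion_le_card_mul _ _ ((4 * n) ^ 2) ?_).trans
          (Nat.mul_le_mul_right _ ?_)
        · intro y hy
          obtain ⟨a, ha, b, hb, rfl⟩ := Finset.mem_image₂.1 hy
          refine (card_factors_le _).trans (Nat.pow_le_pow_left ?_ 2)
          rw [List.length_append, hU _ a ha, hU _ b hb]
          omega
        · refine (Finset.card_image₂_le _ _ _).trans ?_
          rw [hcU]
      have h2 := Finset.card_union_le hfin.toFinset
        ((Finset.image₂ (fun x y => x ++ y) (U (k + 1)) (U (k + 1))).biUnion factors)
      -- From n = 1024 on, 16 n⁴ ≤ n⁵ / 64 ≤ S; below, 16 n⁴ ≤ 16 · 1024⁴ = 2⁴⁴.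
      have h3 : n * n * (4 * n) ^ 2 ≤ S + 2 ^ 44 := by
        rcases Nat.lt_or_ge n 1024 with h | h
        · have : n ^ 4 ≤ 1024 ^ 4 := Nat.pow_le_pow_left h.le 4
          have e : n * n * (4 * n) ^ 2 = 16 * n ^ 4 := by ring
          rw [e]
          norm_num at this ⊢
          omega
        · have : 1024 * n ^ 4 ≤ n * n ^ 4 := Nat.mul_le_mul_right _ h
          have e : n * n * (4 * n) ^ 2 = 16 * n ^ 4 := by ring
          have e' : n * n ^ 4 = n ^ 5 := by ring
          rw [e]
          omega
      omega

end Blocks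

/-! ### Layers of prescribed approximate size. -/

section Layers

variable {X : Type w}

/-- A finite factor closed set of words of length at most `5 * N` whose size is close to `T`. -/
def IsLayer (N T : ℕ) (E : Finset (List X)) : Prop :=
  (∀ x ∈ E, ∀ y, y <:+: x → y ∈ E) ∧ (∀ x ∈ E, x.length ≤ 5 * N) ∧ T ≤ E.card ∧
    E.card ≤ T + (5 * N + 1) ^ 2

/-- The products of five blocks are longer than all words of `E`, so they are |U|⁵ new words, enough
to reach `T`; a suitable subset of them, with its factors, stays close to `T`. -/
lemma exists_layer_of_block {U : Finset (List X)} {N T T' N' : ℕ} (hU : ∀ x ∈ U, x.length = N)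
    (hN : N' < N) (hTT : T' ≤ T) {E : Finset (List X)}
    (hclosed : ∀ x ∈ E, ∀ y, y <:+: x → y ∈ E) (hlen : ∀ x ∈ E, x.length ≤ 5 * N')
    (hlow : T' ≤ E.card) (hup : E.card ≤ T' + (5 * N' + 1) ^ 2) (hT : T ≤ T' + U.card ^ 5) :
    ∃ E' : Finset (List X), IsLayer N T E' ∧ E ⊆ E' ∧
      ∀ x ∈ E', x ∈ E ∨ ∃ y, IsProd U y ∧ x <:+: y := by
  classical
  have hP : ∀ y ∈ prodPow U 5, y.length = 5 * N := fun y hy => length_of_mem_prodPow hU hy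
  have hbig : T ≤ (E ∪ (prodPow U 5).biUnion factors).card := by
    have hdisj : Disjoint E (prodPow U 5) := by
      rw [Finset.disjoint_left]
      intro x hx hx'
      have := hlen x hx
      have := hP x hx'
      omega
    have h1 := Finset.card_union_of_disjoint hdisj
    rw [card_prodPow hU] at h1
    have h2 : E ∪ prodPow U 5 ⊆ E ∪ (prodPow U 5).biUnion factors :=
      Finset.union_subset_union_right fun x hx =>
        Finset.mem_biUnion.2 ⟨x, hx, mem_factors.2 (List.infix_refl x)⟩
    have := Finset.card_le_card h2
    omega
  obtain ⟨D, hD, h1, h2⟩ := exists_subset_card_union_factors E (prodPow U 5) hP hbig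
  have hmono : (5 * N' + 1) ^ 2 ≤ (5 * N + 1) ^ 2 := Nat.pow_le_pow_left (by omega) 2
  refine ⟨E ∪ D.biUnion factors, ⟨?_, ?_, h1, h2.trans (max_le (by omega) le_rfl)⟩,
    Finset.subset_union_left, ?_⟩
  · intro x hx y hyx
    simp only [Finset.mem_union, Finset.mem_biUnion, mem_factors] at hx ⊢
    rcases hx with hx | ⟨w, hw, hx⟩
    · exact Or.inl (hclosed x hx y hyx)
    · exact Or.inr ⟨w, hw, hyx.trans hx⟩
  · intro x hx
    simp only [Finset.mem_union, Finset.mem_biUnion, mem_factors] at hx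
    rcases hx with hx | ⟨w, hw, hx⟩
    · have := hlen x hx
      omega
    · rw [← hP w (hD hw)]
      exact hx.length_le
  · intro x hx
    simp only [Finset.mem_union, Finset.mem_biUnion, mem_factors] at hx
    rcases hx with hx | ⟨w, hw, hx⟩
    · exact Or.inl hx
    · exact Or.inr ⟨w, isProd_of_mem_prodPow (hD hw), hx⟩

lemma exists_layers {F : ℕ → ℕ} (hF : Monotone F) {c : ℕ → ℕ}
    (hc : ∀ k, dyadicStep F k ≤ c k ^ 5) {U : ℕ → Finset (List X)}
    (hU : ∀ k, (∀ x ∈ U k, x.length = 2 ^ k) ∧ c k ≤ (U k).card) :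
    ∃ E : ℕ → Finset (List X), (∀ k, IsLayer (2 ^ k) (F (2 ^ (k + 1))) (E k)) ∧ Monotone E ∧
      (∀ x ∈ E 0, ∃ y, IsProd (U 0) y ∧ x <:+: y) ∧
      ∀ k, ∀ x ∈ E (k + 1), x ∈ E k ∨ ∃ y, IsProd (U (k + 1)) y ∧ x <:+: y := by
  have hpow : ∀ k, dyadicStep F k ≤ (U k).card ^ 5 := fun k =>
    (hc k).trans (Nat.pow_le_pow_left (hU k).2 5)
  -- The bottom layer is built on the empty set, with previous target 0; this is why `dyadicStep F
  -- 0` is all of F(2).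
  obtain ⟨E0, hE0, -, hE0'⟩ := exists_layer_of_block (hU 0).1 (N' := 0) (T := F (2 ^ (0 + 1)))
    (T' := 0) (E := ∅) (by simp) (Nat.zero_le _) (by simp) (by simp) (by simp) (by simp)
    (by have := hpow 0; simp only [dyadicStep] at this; simpa using this)
  have hstep : ∀ k (E : {E : Finset (List X) // IsLayer (2 ^ k) (F (2 ^ (k + 1))) E}),
      ∃ E' : {E : Finset (List X) // IsLayer (2 ^ (k + 1)) (F (2 ^ (k + 1 + 1))) E},
        E.1 ⊆ E'.1 ∧ ∀ x ∈ E'.1, x ∈ E.1 ∨ ∃ y, IsProd (U (k + 1)) y ∧ x <:+: y := by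
    rintro k ⟨E, h1, h2, h3, h4⟩
    obtain ⟨E', h, h'⟩ := exists_layer_of_block (hU (k + 1)).1 (N' := 2 ^ k)
      (T := F (2 ^ (k + 1 + 1))) (T' := F (2 ^ (k + 1))) (E := E)
      (Nat.pow_lt_pow_right (by norm_num) (by omega))
      (hF (Nat.pow_le_pow_right (by norm_num) (by omega))) h1 h2 h3 h4
      (by have : F (2 ^ (k + 1 + 1)) - F (2 ^ (k + 1)) ≤ _ := hpow (k + 1); omega)
    exact ⟨⟨E', h⟩, h'⟩
  choose g hg using hstep
  let s : ∀ k, {E : Finset (List X) // IsLayer (2 ^ k) (F (2 ^ (k + 1))) E} := fun k =>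
    Nat.rec ⟨E0, hE0⟩ g k
  refine ⟨fun k => (s k).1, fun k => (s k).2, monotone_nat_of_le_succ fun k => (hg k (s k)).1,
    fun x hx => ?_, fun k => (hg k (s k)).2⟩
  rcases hE0' x hx with h | h
  · simp at h
  · exact h

end Layers

/-! ### Languages realizing admissible functions. -/

/-- A gap function is equivalent to the growth function of a hereditary language. -/
theorem IsGapFun.exists_language {F : ℕ → ℕ} (hF : IsGapFun F) :
    ∃ f, IsLanguageGrowth.{w} f ∧ AsympEquiv F f := by
  classical
  obtain ⟨c, hc⟩ := hF.exists_block_numbers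
  -- The letters must include `c 0` blocks of length 1 and the two distinct letters of sparse words.
  let X := ULift.{w} (Fin (c 0 + 2))
  let z : X := ⟨0⟩
  let o : X := ⟨1⟩
  have hzo : z ≠ o := fun h => Fin.zero_ne_one (congrArg ULift.down h)
  obtain ⟨U, hU, hnext⟩ := exists_blocks (X := X) hzo (fun k => (hc k).2.2.2)
    (fun k => (hc k).2.2.1) (by simp [X])
  have hne : ∀ k, (U k).Nonempty := fun k => by
    rw [← Finset.card_pos]
    have := (hU k).2
    have := (hc k).2.2.2
    omega
  obtain ⟨E, hE, hmono, hzero, hsucc⟩ := exists_layers hF.1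
    (fun k => (by have := (hc k).1; omega : dyadicStep F k ≤ c k ^ 5)) hU
  let L : Set (List X) := {x | ∃ k, x ∈ E k}
  have hL : FactorClosed L := fun x y ⟨k, hx⟩ hyx => ⟨k, (hE k).1 x hx y hyx⟩
  have hnil : [] ∈ L := by
    have h : 0 < (E 0).card :=
      lt_of_lt_of_le (hF.one_le_zero.trans (hF.1 (Nat.zero_le _))) (hE 0).2.2.1
    obtain ⟨x, hx⟩ := Finset.card_pos.1 h
    exact ⟨0, (hE 0).1 x hx [] List.nil_infix⟩
  have hprod : ∀ j x, x ∈ E j → ∀ k ≤ j, x ∈ E k ∨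
      ∃ i, k + 1 ≤ i ∧ ∃ y, IsProd (U i) y ∧ x <:+: y := by
    intro j x hx k hk
    induction j, hk using Nat.le_induction with
    | base => exact Or.inl hx
    | succ j hj ih =>
      rcases hsucc j x hx with h | h
      · exact ih h
      · exact Or.inr ⟨j + 1, by omega, h⟩
  -- Short words lie in `E k` or are counted by `ncard_short_le`. The main terms F(2^(k+1)) and
  -- `dyadicStep F (k + 1)` add up to F(2^(k+2)); the quadratic errors and 2⁴⁴ fit into the growth
  -- of F up to 2^(k+50).
  have hupper : ∀ k, wordCount L (2 ^ k) ≤ F (2 ^ (k + 50)) := by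
    intro k
    obtain ⟨G, hG, hGcard⟩ := ncard_short_le (fun k => (hU k).1) hnext (hc (k + 1)).2.1
    have hsub : {x : List X | x ∈ L ∧ x.length ≤ 2 ^ k} ⊆ ↑(E k ∪ G) := by
      rintro x ⟨⟨j, hj⟩, hx⟩
      rw [Finset.coe_union]
      rcases le_total j k with h | h
      · exact Or.inl (hmono h hj)
      · rcases hprod j x hj k h with h | ⟨i, hi, y, hy, hxy⟩
        · exact Or.inl h
        · exact Or.inr (hG x hx
            (infix_append_or_isSparse (fun k => (hU k).1) hne hnext hi hy hxy hx))
    have h1 : wordCount L (2 ^ k) ≤ (E k ∪ G).card := by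
      rw [← Set.ncard_coe_finset]
      exact Set.ncard_le_ncard hsub (Finset.finite_toSet _)
    have h2 := Finset.card_union_le (E k) G
    have h3 := (hE k).2.2.2
    have h4 := hF.add_mul_le (2 ^ (k + 2)) (2 ^ (k + 50) - 2 ^ (k + 2))
    have h5 : 2 ^ (k + 2) ≤ 2 ^ (k + 49) := Nat.pow_le_pow_right (by norm_num) (by omega)
    have h5' : 0 < 2 ^ (k + 49) := by positivity
    have h6 : 2 ^ (k + 50) = 2 ^ (k + 49) + 2 ^ (k + 49) := by ring
    have h7 : 2 ^ (k + 49) * 2 ^ (k + 2) ≤ (2 ^ (k + 50) - 2 ^ (k + 2)) * 2 ^ (k + 2) :=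
      Nat.mul_le_mul_right _ (by omega)
    rw [Nat.add_sub_of_le (h5.trans (by omega))] at h4
    have h8 : 2 ^ (k + 49) * 2 ^ (k + 2) = 2 ^ 51 * (2 ^ k) ^ 2 := by ring
    have h9 : F (2 ^ (k + 1)) ≤ F (2 ^ (k + 2)) :=
      hF.1 (Nat.pow_le_pow_right (by norm_num) (by omega))
    have h10 : (5 * 2 ^ k + 1) ^ 2 + 2 * (2 ^ k + 1) ^ 2 + 2 ^ 44 ≤ 2 ^ 51 * (2 ^ k) ^ 2 := by
      have : 1 ≤ 2 ^ k := Nat.one_le_two_pow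
      norm_num
      nlinarith
    change _ ≤ _ + (F (2 ^ (k + 2)) - F (2 ^ (k + 1))) + _ at hGcard
    omega
  have hlower : ∀ k, F (2 ^ (k + 1)) ≤ wordCount L (5 * 2 ^ k) := by
    intro k
    refine (hE k).2.2.1.trans ?_
    rw [← Set.ncard_coe_finset]
    exact Set.ncard_le_ncard (fun x hx => ⟨⟨k, hx⟩, (hE k).2.1 x hx⟩)
      (finite_words_length_le L _)
  refine ⟨wordCount L, ⟨X, inferInstance, Lᶜ, fun h => h hnil, (languageGrowth_compl hL).symm⟩,
    ⟨10, by norm_num, fun n hn => ?_⟩, ⟨2 ^ 51, Nat.one_le_two_pow, fun n hn => ?_⟩⟩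
  · have h1 : 2 ^ Nat.log 2 n ≤ n := Nat.pow_log_le_self 2 (by omega)
    have h2 : n < 2 ^ (Nat.log 2 n + 1) := Nat.lt_pow_succ_log_self (by norm_num) n
    exact (hF.1 h2.le).trans ((hlower _).trans (wordCount_mono L (by omega)))
  · have h1 : 2 ^ Nat.log 2 n ≤ n := Nat.pow_log_le_self 2 (by omega)
    have h2 : n < 2 ^ (Nat.log 2 n + 1) := Nat.lt_pow_succ_log_self (by norm_num) n
    refine (wordCount_mono L h2.le).trans ((hupper _).trans (hF.1 ?_))
    calc 2 ^ (Nat.log 2 n + 1 + 50) = 2 ^ 51 * 2 ^ Nat.log 2 n := by ring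
      _ ≤ 2 ^ 51 * n := Nat.mul_le_mul_left _ h1

/-- A positive constant function is equivalent to the growth function of a finite language. -/
lemma IsConstantFun.exists_language {F : ℕ → ℕ} (hF : IsConstantFun F) :
    ∃ f, IsLanguageGrowth.{w} f ∧ AsympEquiv F f := by
  obtain ⟨c, hc, hF⟩ := hF
  -- Together with the empty word, the c - 1 letters give c words.
  let X := ULift.{w} (Fin (c - 1))
  let L : Set (List X) := {x | x.length ≤ 1}
  have hL : FactorClosed L := fun x y hx hyx => hyx.length_le.trans hx
  refine ⟨wordCount L, ⟨X, inferInstance, Lᶜ, fun h => h (Nat.zero_le _),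
    (languageGrowth_compl hL).symm⟩, AsympEquiv.of_eq fun n hn => ?_⟩
  have : {x : List X | x ∈ L ∧ x.length ≤ n} = insert [] ((fun a => [a]) '' Set.univ) := by
    ext x
    simp only [L, Set.mem_ofPred_eq, Set.mem_insert_iff, Set.image_univ, Set.mem_range]
    constructor
    · rintro ⟨h, -⟩
      rcases x with _ | ⟨a, _ | ⟨b, x⟩⟩
      · simp
      · simp
      · simp at h
    · rintro (rfl | ⟨a, rfl⟩)
      · simp
      · simpa using hn
  rw [wordCount, this, Set.ncard_insert_of_notMem (by simp) (Set.toFinite _),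
    Set.ncard_image_of_injective _ (fun a b h => by simpa using h), Set.ncard_univ, hF]
  simp [X]
  omega

/-- A linear function is equivalent to the growth function of the language of all words in one
letter. -/
lemma IsLinearFun.exists_language {F : ℕ → ℕ} (hF : IsLinearFun F) :
    ∃ f, IsLanguageGrowth.{w} f ∧ AsympEquiv F f := by
  obtain ⟨a, b, ha, hF⟩ := hF
  let L : Set (List PUnit.{w + 1}) := Set.univ
  have hL : FactorClosed L := fun x y hx hyx => trivial
  have hcount : ∀ n, wordCount L n = n + 1 := by
    intro n
    have : {x : List PUnit.{w + 1} | x ∈ L ∧ x.length ≤ n} =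
        ↑((Finset.range (n + 1)).image fun i => List.replicate i PUnit.unit) := by
      ext x
      simp only [L, Set.mem_univ, true_and, Set.mem_ofPred_eq, Finset.coe_image, Set.mem_image,
        Finset.mem_coe, Finset.mem_range]
      constructor
      · intro h
        exact ⟨x.length, by omega, (List.eq_replicate_of_mem fun _ _ => rfl).symm⟩
      · rintro ⟨i, hi, rfl⟩
        simp
        omega
    rw [wordCount, this, Set.ncard_coe_finset, Finset.card_image_of_injective, Finset.card_range]
    intro i j hij
    simpa using congrArg List.length hij
  refine ⟨wordCount L, ⟨PUnit, inferInstance, Lᶜ, fun h => h trivial,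
    (languageGrowth_compl hL).symm⟩, ⟨a + b, by omega, fun n hn => ?_⟩,
    ⟨2, by norm_num, fun n hn => ?_⟩⟩
  · rw [hF, hcount]
    nlinarith
  · rw [hF, hcount]
    nlinarith

/-- An admissible function is equivalent to the growth function of a hereditary language. -/
theorem IsAdmissible.exists_language {F : ℕ → ℕ} (hF : IsAdmissible F) :
    ∃ f, IsLanguageGrowth.{w} f ∧ AsympEquiv F f := by
  rcases hF with hF | hF | hF
  · exact hF.exists_language
  · exact hF.exists_language
  · exact hF.exists_language

/-! ### Powers of generating sets under homomorphisms and spans. -/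

section PowSet

lemma subset_ball {S : Type w} [Mul S] (X : Set S) {n : ℕ} (hn : 1 ≤ n) : X ⊆ ball X n :=
  fun _ hx => ⟨1, le_rfl, hn, hx⟩

lemma powSet_subset_closure {S : Type w} [Semigroup S] (X : Set S) (m : ℕ) :
    powSet X m ⊆ Subsemigroup.closure X := by
  match m with
  | 0 => exact Set.empty_subset _
  | 1 => exact Subsemigroup.subset_closure
  | m + 2 =>
    rintro _ ⟨a, ha, x, hx, rfl⟩
    exact mul_mem (powSet_subset_closure X (m + 1) ha) (Subsemigroup.subset_closure hx)

lemma powSet_finite {S : Type w} [Mul S] {X : Set S} (hX : X.Finite) (m : ℕ) :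
    (powSet X m).Finite := by
  match m with
  | 0 => exact Set.finite_empty
  | 1 => exact hX
  | m + 2 => exact (powSet_finite hX (m + 1)).image2 _ hX

lemma ball_finite {S : Type w} [Mul S] {X : Set S} (hX : X.Finite) (n : ℕ) :
    (ball X n).Finite := by
  refine ((Set.finite_Iic n).biUnion fun m _ => powSet_finite hX m).subset ?_
  rintro a ⟨m, _, hm, ha⟩
  exact Set.mem_biUnion hm ha

lemma powSet_image {S : Type v} {T : Type w} [Mul S] [Mul T] (φ : S →ₙ* T) (X : Set S) (m : ℕ) :
    powSet (φ '' X) m = φ '' powSet X m := by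
  match m with
  | 0 => exact (Set.image_empty _).symm
  | 1 => rfl
  | m + 2 =>
    rw [powSet, powSet, powSet_image φ X (m + 1)]
    exact (Set.image_image2_distrib (map_mul φ)).symm

lemma ball_image {S : Type v} {T : Type w} [Mul S] [Mul T] (φ : S →ₙ* T) (X : Set S) (n : ℕ) :
    ball (φ '' X) n = φ '' ball X n := by
  ext y
  simp only [ball, powSet_image, Set.mem_ofPred_eq, Set.mem_image]
  constructor
  · rintro ⟨m, h1, h2, x, hx, rfl⟩
    exact ⟨x, ⟨m, h1, h2, hx⟩, rfl⟩
  · rintro ⟨x, ⟨m, h1, h2, hx⟩, rfl⟩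
    exact ⟨m, h1, h2, x, hx, rfl⟩

lemma finrank_span_image_of_linearIndepOn {k : Type u} [Field k] {M : Type v} [AddCommGroup M]
    [Module k M] {ι : Type w} {s : Set ι} (hs : s.Finite) {φ : ι → M}
    (h : LinearIndepOn k φ s) : Module.finrank k (Submodule.span k (φ '' s)) = s.ncard := by
  have := hs.fintype
  rw [Set.image_eq_range, finrank_span_eq_card h, ← Nat.card_coe_set_eq, Nat.card_eq_fintype_card]

variable {k : Type u} [Field k] {A : Type v} [NonUnitalRing A] [Module k A] [IsScalarTower k A A]
  [SMulCommClass k A A]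

lemma powSet_mono {S : Type w} [Mul S] {X Y : Set S} (h : X ⊆ Y) (m : ℕ) :
    powSet X m ⊆ powSet Y m := by
  match m with
  | 0 => exact le_rfl
  | 1 => exact h
  | m + 2 => exact Set.image2_subset (powSet_mono h (m + 1)) h

lemma powSet_span_subset (Y : Set A) (m : ℕ) :
    powSet (Submodule.span k Y : Set A) m ⊆ Submodule.span k (powSet Y m) := by
  match m with
  | 0 => exact Set.empty_subset _
  | 1 => exact le_rfl
  | m + 2 =>
    rintro _ ⟨a, ha, x, hx, rfl⟩
    have h := Submodule.apply_mem_map₂ (LinearMap.mul k A) (powSet_span_subset Y (m + 1) ha) hx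
    rw [Submodule.map₂_span_span] at h
    exact h

lemma span_ball_span (Y : Set A) (n : ℕ) :
    Submodule.span k (ball (Submodule.span k Y : Set A) n) = Submodule.span k (ball Y n) := by
  apply le_antisymm
  · refine Submodule.span_le.2 ?_
    rintro a ⟨m, h1, h2, ha⟩
    have h : powSet Y m ⊆ ball Y n := fun x hx => ⟨m, h1, h2, hx⟩
    exact Submodule.span_mono h (powSet_span_subset Y m ha)
  · refine Submodule.span_mono ?_
    rintro a ⟨m, h1, h2, ha⟩
    exact ⟨m, h1, h2, powSet_mono Submodule.subset_span m ha⟩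

end PowSet

/-! ### From languages to semigroups and semigroup algebras. -/

section Semigroups

variable {X : Type w}

open Classical in
/-- Concatenation of words of a language, where the empty word serves as the value of all products
with the empty word and of all products outside of the language. -/
noncomputable def wordMul {L : Set (List X)} (hnil : [] ∈ L) (a b : L) : L :=
  if h : a.1 ≠ [] ∧ b.1 ≠ [] ∧ a.1 ++ b.1 ∈ L then ⟨a.1 ++ b.1, h.2.2⟩ else ⟨[], hnil⟩

open Classical in
lemma coe_wordMul {L : Set (List X)} (hnil : [] ∈ L) (a b : L) : (wordMul hnil a b).1 =
    if a.1 ≠ [] ∧ b.1 ≠ [] ∧ a.1 ++ b.1 ∈ L then a.1 ++ b.1 else [] := by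
  rw [wordMul]
  split_ifs <;> rfl

lemma wordMul_assoc {L : Set (List X)} (hL : FactorClosed L) (hnil : [] ∈ L) (a b c : L) :
    wordMul hnil (wordMul hnil a b) c = wordMul hnil a (wordMul hnil b c) := by
  classical
  apply Subtype.ext
  rw [coe_wordMul, coe_wordMul, coe_wordMul, coe_wordMul]
  have h1 : a.1 ++ (b.1 ++ c.1) ∈ L → a.1 ++ b.1 ∈ L := fun h => hL h ⟨[], c.1, by simp⟩
  have h2 : a.1 ++ (b.1 ++ c.1) ∈ L → b.1 ++ c.1 ∈ L := fun h => hL h ⟨a.1, [], by simp⟩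
  by_cases ha : a.1 = []
  · simp [ha]
  by_cases hb : b.1 = []
  · simp [hb]
  by_cases hc : c.1 = []
  · simp [hc]
  by_cases hab : a.1 ++ b.1 ∈ L
  · by_cases hbc : b.1 ++ c.1 ∈ L
    · simp [ha, hb, hc, hab, hbc]
    · have : a.1 ++ (b.1 ++ c.1) ∉ L := fun h => hbc (h2 h)
      simp [ha, hb, hc, hab, hbc, this]
  · have : a.1 ++ (b.1 ++ c.1) ∉ L := fun h => hab (h1 h)
    by_cases hbc : b.1 ++ c.1 ∈ L
    · simp [ha, hb, hc, hab, hbc, this]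
    · simp [hab, hbc]

/-- The semigroup of words of a factor closed language, with the empty word as zero element. -/
noncomputable abbrev wordSemigroup {L : Set (List X)} (hL : FactorClosed L) (hnil : [] ∈ L) :
    Semigroup L where
  mul := wordMul hnil
  mul_assoc := wordMul_assoc hL hnil

/-- The growth function of a hereditary language is that of a semigroup. -/
theorem IsLanguageGrowth.exists_semigroup {f : ℕ → ℕ} (hf : IsLanguageGrowth.{w} f) :
    ∃ f', IsSemigroupGrowth.{w} f' ∧ AsympEquiv f f' := by
  classical
  obtain ⟨X, _, W, hW, rfl⟩ := hf
  set L := hereditaryLanguage W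
  have hL : FactorClosed L := factorClosed_hereditaryLanguage W
  have hnil : [] ∈ L := nil_mem_hereditaryLanguage hW
  let _ : Semigroup L := wordSemigroup hL hnil
  have hmul : ∀ a b : L, (a * b).1 =
      if a.1 ≠ [] ∧ b.1 ≠ [] ∧ a.1 ++ b.1 ∈ L then a.1 ++ b.1 else [] := coe_wordMul hnil
  -- The zero is itself a generator, so it lies in every power of `Y`, also when there are no
  -- letters.
  let Y : Set L := {a | a.1 = [] ∨ a.1.length = 1}
  have hpow : ∀ m, powSet Y (m + 1) = {a | a.1 = [] ∨ a.1.length = m + 1} := by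
    intro m
    induction m with
    | zero => rfl
    | succ m ih =>
      ext a
      rw [powSet, ih]
      constructor
      · rintro ⟨b, hb, x, hx, rfl⟩
        simp only [Set.mem_ofPred_eq, Y] at hb hx ⊢
        rw [hmul]
        split_ifs with h
        · right
          rw [List.length_append]
          have := hb.resolve_left h.1
          have := hx.resolve_left h.2.1
          omega
        · exact Or.inl rfl
      · rintro (h | h)
        · refine ⟨⟨[], hnil⟩, Or.inl rfl, ⟨[], hnil⟩, Or.inl rfl, Subtype.ext ?_⟩
          rw [hmul, h]
          simp
        · rcases List.eq_nil_or_concat a.1 with h' | ⟨b, x, h'⟩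
          · rw [h'] at h
            simp at h
          · have hb : b.length = m + 1 := by
              rw [h'] at h
              simpa using h
            have ha : b ++ [x] ∈ L := by
              rw [← List.concat_eq_append, ← h']
              exact a.2
            refine ⟨⟨b, hL ha (List.prefix_append _ _).isInfix⟩, Or.inr hb,
              ⟨[x], hL ha (List.suffix_append _ _).isInfix⟩, Or.inr rfl, Subtype.ext ?_⟩
            have hne : b ≠ [] := by
              rintro rfl
              simp at hb
            rw [hmul, if_pos ⟨hne, by simp, ha⟩, h', List.concat_eq_append]
  have hball : ∀ n, 1 ≤ n → ball Y n = {a | a.1.length ≤ n} := by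
    intro n hn
    ext a
    constructor
    · rintro ⟨m, h1, h2, h⟩
      obtain ⟨m, rfl⟩ : ∃ j, m = j + 1 := ⟨m - 1, by omega⟩
      rw [hpow] at h
      rcases h with h | h
      · simp [h]
      · rw [Set.mem_ofPred_eq]
        omega
    · intro h
      rcases Nat.eq_zero_or_pos a.1.length with h0 | h0
      · exact subset_ball Y hn (Or.inl (List.length_eq_zero_iff.1 h0))
      · refine ⟨a.1.length, h0, h, ?_⟩
        obtain ⟨j, hj⟩ : ∃ j, a.1.length = j + 1 := ⟨a.1.length - 1, by omega⟩
        rw [hj, hpow]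
        exact Or.inr hj
  refine ⟨semigroupGrowth Y, ⟨L, inferInstance, ⟨⟨[], hnil⟩⟩, Y, ?_, ?_, rfl⟩,
    AsympEquiv.of_eq fun n hn => ?_⟩
  · refine Set.Finite.subset ((List.finite_length_le X 1).preimage
      Subtype.val_injective.injOn) ?_
    rintro a (h | h)
    · simp [h]
    · exact h.le
  · rw [eq_top_iff]
    intro a _
    obtain ⟨m, -, -, h⟩ : a ∈ ball Y (a.1.length + 1) := by
      rw [hball _ (by omega)]
      exact Nat.le_succ _
    exact powSet_subset_closure Y m h
  · rw [semigroupGrowth, hball n hn, ← Set.ncard_image_of_injective _ Subtype.val_injective,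
      languageGrowth]
    congr 1
    ext x
    constructor
    · exact fun h => ⟨⟨x, h.1⟩, h.2, rfl⟩
    · rintro ⟨a, h, rfl⟩
      exact ⟨a.2, h⟩

/-- The growth function of a semigroup is that of its semigroup algebra. -/
theorem IsSemigroupGrowth.isAlgebraGrowth (k : Type u) [Field k] {f : ℕ → ℕ}
    (hf : IsSemigroupGrowth.{w} f) : IsAlgebraGrowth.{u, max u w} k f := by
  obtain ⟨S, _, _, X, hX, hgen, rfl⟩ := hf
  let φ : S →ₙ* MonoidAlgebra k S := MonoidAlgebra.ofMagma k S
  have hφ : LinearIndependent k φ := by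
    refine LinearIndependent.of_comp (MonoidAlgebra.coeffLinearEquiv k).toLinearMap ?_
    exact Finsupp.linearIndependent_single_one k S
  refine ⟨MonoidAlgebra k S, inferInstance, inferInstance, inferInstance, inferInstance,
    inferInstance, Submodule.span k (φ '' X), FiniteDimensional.span_of_finite k (hX.image _),
    ?_, ?_⟩
  · rw [eq_top_iff]
    intro a _
    have hS : ∀ s, φ s ∈ NonUnitalAlgebra.adjoin k (Submodule.span k (φ '' X) : Set _) := by
      intro s
      have hs : s ∈ Subsemigroup.closure X := hgen ▸ Subsemigroup.mem_top s
      induction hs using Subsemigroup.closure_induction with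
      | mem x hx =>
        exact NonUnitalAlgebra.subset_adjoin k (Submodule.subset_span ⟨x, hx, rfl⟩)
      | mul x y _ _ hx hy =>
        rw [map_mul]
        exact mul_mem hx hy
    induction a using MonoidAlgebra.induction_linear with
    | zero => exact zero_mem _
    | add a b ha hb => exact add_mem (ha trivial) (hb trivial)
    | single s c =>
      have := SMulMemClass.smul_mem c (hS s)
      simpa [φ] using this
  · funext n
    rw [algebraGrowth, span_ball_span, ball_image,
      finrank_span_image_of_linearIndepOn (ball_finite hX n)
        (hφ.comp _ Subtype.val_injective)]
    rfl

end Semigroups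

/-! ### From languages to unital monomial algebras. -/

section MonomialAlgebras

variable (k : Type u) [Field k] {X : Type}

open Classical in
/-- Left multiplication by a letter on the space of words, where words outside of the language
`L` are set to zero. -/
noncomputable def letterOperator (L : Set (List X)) (x : X) : Module.End k (List X →₀ k) :=
  Finsupp.linearCombination k fun w => if x :: w ∈ L then Finsupp.single (x :: w) 1 else 0

variable {k} {L : Set (List X)}

open Classical in
-- The formula needs a nonempty word: the empty word acts as the identity and does not kill `v`
-- outside of `L`.
lemma evalWord_letterOperator_cons (hL : FactorClosed L) (x : X) (w v : List X) :
    evalWord (letterOperator k L) (x :: w) (Finsupp.single v 1) =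
      if x :: w ++ v ∈ L then Finsupp.single (x :: w ++ v) 1 else 0 := by
  induction w generalizing x with
  | nil => simp [evalWord, letterOperator]
  | cons y w ih =>
    rw [show x :: y :: w = [x] ++ y :: w from rfl, evalWord_append, Module.End.mul_apply, ih]
    split_ifs with h1 h2 h2
    · have h3 : x :: y :: (w ++ v) ∈ L := by simpa using h2
      simp [evalWord, letterOperator, h3]
    · have h3 : x :: y :: (w ++ v) ∉ L := by simpa using h2
      simp [evalWord, letterOperator, h3]
    · exact absurd (hL h2 ⟨[x], [], by simp⟩) h1
    · simp

lemma evalWord_letterOperator_of_mem (hL : FactorClosed L) {w : List X} (hw : w ∈ L) :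
    evalWord (letterOperator k L) w (Finsupp.single [] 1) = Finsupp.single w 1 := by
  cases w with
  | nil => simp [evalWord]
  | cons x w => rw [evalWord_letterOperator_cons hL, List.append_nil, if_pos hw]

lemma evalWord_letterOperator_of_notMem (hL : FactorClosed L) (hnil : [] ∈ L) {w : List X}
    (hw : w ∉ L) : evalWord (letterOperator k L) w = 0 := by
  cases w with
  | nil => exact absurd hnil hw
  | cons x w =>
    apply Finsupp.lhom_ext'
    intro v
    apply LinearMap.ext_ring
    have h : x :: w ++ v ∉ L := fun h => hw (hL h (List.prefix_append _ _).isInfix)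
    have h' := evalWord_letterOperator_cons (k := k) hL x w v
    rw [if_neg h] at h'
    simpa using h'

/-- Factors 1 pad shorter words, so products of exactly `n` generators already give all words of
length at most `n`. -/
lemma ball_insert_one {B : Type v} [Ring B] (e : X → B) {n : ℕ} (hn : 1 ≤ n) :
    ball (insert 1 (Set.range e)) n = evalWord e '' {w | w.length ≤ n} := by
  have hpow : ∀ m, powSet (insert 1 (Set.range e)) (m + 1) =
      evalWord e '' {w | w.length ≤ m + 1} := by
    intro m
    induction m with
    | zero =>
      ext a
      constructor
      · rintro (rfl | ⟨x, rfl⟩)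
        · exact ⟨[], by simp, by simp [evalWord]⟩
        · exact ⟨[x], by simp, by simp [evalWord]⟩
      · rintro ⟨w, hw, rfl⟩
        rcases w with _ | ⟨x, _ | ⟨y, w⟩⟩
        · exact Or.inl (by simp [evalWord])
        · exact Or.inr ⟨x, by simp [evalWord]⟩
        · simp at hw
    | succ m ih =>
      rw [powSet, ih]
      ext a
      constructor
      · rintro ⟨_, ⟨w, hw, rfl⟩, x, hx, rfl⟩
        rw [Set.mem_ofPred_eq] at hw
        rcases hx with rfl | ⟨x, rfl⟩
        · exact ⟨w, by rw [Set.mem_ofPred_eq]; omega, by simp⟩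
        · exact ⟨w ++ [x], by simpa using hw, by simp [evalWord]⟩
      · rintro ⟨w, hw, rfl⟩
        rcases List.eq_nil_or_concat w with rfl | ⟨v, x, rfl⟩
        · exact ⟨1, ⟨[], by simp, by simp [evalWord]⟩, 1, Or.inl rfl, by simp [evalWord]⟩
        · exact ⟨evalWord e v, ⟨v, by simpa using hw, rfl⟩, e x, Or.inr ⟨x, rfl⟩,
            by simp [evalWord]⟩
  ext a
  constructor
  · rintro ⟨m, h1, h2, h⟩
    obtain ⟨m, rfl⟩ : ∃ j, m = j + 1 := ⟨m - 1, by omega⟩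
    rw [hpow] at h
    exact Set.image_mono (fun w hw => le_trans hw h2) h
  · intro h
    refine ⟨n, hn, le_rfl, ?_⟩
    obtain ⟨m, rfl⟩ : ∃ j, n = j + 1 := ⟨n - 1, by omega⟩
    rwa [hpow]

/-- If the words outside of a language vanish in an algebra, and the words of the language are
linearly independent, then the language has the same growth as the subalgebra generated by the
letters. -/
lemma exists_unital_algebra_of_generators [Finite X] {E : Type v} [Ring E] [Algebra k E]
    [Nontrivial E] (e : X → E) (hzero : ∀ w ∉ L, evalWord e w = 0)
    (hli : LinearIndepOn k (evalWord e) L) :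
    ∃ f, IsUnitalAlgebraGrowth.{u, v} k f ∧ ∀ n, 1 ≤ n → f n = wordCount L n := by
  let B : Subalgebra k E := Algebra.adjoin k (Set.range e)
  let t : X → B := fun x => ⟨e x, Algebra.subset_adjoin ⟨x, rfl⟩⟩
  have heval : ∀ w, ((evalWord t w : B) : E) = evalWord e w := by
    intro w
    simp only [evalWord]
    induction w with
    | nil => simp
    | cons x w ih => simp [ih, t]
  let V : Submodule k B := Submodule.span k (insert 1 (Set.range t))
  have hgen : Algebra.adjoin k (V : Set B) = ⊤ := by
    have h : Algebra.adjoin k (Set.range t) = ⊤ := by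
      rw [eq_top_iff, ← Algebra.adjoin_adjoin_coe_preimage (R := k) (s := Set.range e)]
      apply Algebra.adjoin_mono
      rintro ⟨_, _⟩ ⟨x, hx⟩
      exact ⟨x, Subtype.ext hx⟩
    rw [eq_top_iff, ← h]
    exact Algebra.adjoin_mono ((Set.subset_insert _ _).trans Submodule.subset_span)
  refine ⟨algebraGrowth V, ⟨B, inferInstance, inferInstance, inferInstance, V,
    FiniteDimensional.span_of_finite k ((Set.finite_range t).insert 1),
    Submodule.subset_span (Set.mem_insert _ _), hgen, rfl⟩, fun n hn => ?_⟩
  have himage : evalWord e '' {w | w.length ≤ n} =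
      B.val.toLinearMap '' (evalWord t '' {w | w.length ≤ n}) := by
    rw [Set.image_image]
    exact Set.image_congr fun w _ => (heval w).symm
  have hspan : Submodule.span k (evalWord e '' {w | w.length ≤ n}) =
      Submodule.span k (evalWord e '' {w | w ∈ L ∧ w.length ≤ n}) := by
    refine le_antisymm (Submodule.span_le.2 ?_) (Submodule.span_mono (Set.image_mono ?_))
    · rintro _ ⟨w, hw, rfl⟩
      by_cases hwL : w ∈ L
      · exact Submodule.subset_span ⟨w, ⟨hwL, hw⟩, rfl⟩
      · rw [SetLike.mem_coe, hzero w hwL]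
        exact Submodule.zero_mem _
    · exact fun x hx => hx.2
  have hrank := finrank_span_image_of_linearIndepOn (finite_words_length_le L n)
    (hli.mono (Set.sep_subset _ _))
  rw [← hspan, himage, ← Submodule.map_span] at hrank
  rw [algebraGrowth, span_ball_span, ball_insert_one t hn]
  exact (LinearEquiv.finrank_eq
    (Submodule.equivMapOfInjective B.val.toLinearMap Subtype.val_injective _)).trans hrank

/-- Applied to the empty word, the operators of words of `L` become distinct basis vectors. -/
lemma linearIndepOn_evalWord_letterOperator (hL : FactorClosed L) :
    LinearIndepOn k (evalWord (letterOperator k L)) L := by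
  let ev : Module.End k (List X →₀ k) →ₗ[k] (List X →₀ k) :=
    LinearMap.applyₗ (Finsupp.single ([] : List X) (1 : k))
  apply LinearIndependent.of_comp ev
  have h : (ev ∘ fun x : L => evalWord (letterOperator k L) x.1) =
      fun x => Finsupp.single x.1 1 :=
    funext fun x => evalWord_letterOperator_of_mem hL x.2
  rw [h]
  exact (Finsupp.linearIndependent_single_one k (List X)).comp _ Subtype.val_injective

/-- The growth function of a hereditary language is that of a unital monomial algebra. -/
theorem IsLanguageGrowth.exists_unital_algebra (k : Type u) [Field k] {f : ℕ → ℕ}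
    (hf : IsLanguageGrowth.{0} f) :
    ∃ f', IsUnitalAlgebraGrowth.{u, u} k f' ∧ AsympEquiv f f' := by
  obtain ⟨X, _, W, hW, rfl⟩ := hf
  have hL := factorClosed_hereditaryLanguage W
  have hnil := nil_mem_hereditaryLanguage hW
  obtain ⟨f, hf, hfn⟩ := exists_unital_algebra_of_generators
    (letterOperator k (hereditaryLanguage W))
    (fun _ hw => evalWord_letterOperator_of_notMem hL hnil hw)
    (linearIndepOn_evalWord_letterOperator hL)
  exact ⟨f, hf, AsympEquiv.of_eq fun n hn => (hfn n hn).symm⟩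

/-- A finite-dimensional generating subspace with `1` of a unital algebra also generates it as a
non-unital algebra. -/
theorem IsUnitalAlgebraGrowth.isAlgebraGrowth {k : Type u} [Field k] {f : ℕ → ℕ}
    (hf : IsUnitalAlgebraGrowth.{u, v} k f) : IsAlgebraGrowth.{u, v} k f := by
  obtain ⟨A, _, _, _, V, hV, hone, hgen, rfl⟩ := hf
  refine ⟨A, inferInstance, inferInstance, inferInstance, inferInstance, inferInstance, V, hV,
    ?_, rfl⟩
  rw [eq_top_iff]
  intro a _
  have ha : a ∈ Algebra.adjoin k (V : Set A) := hgen ▸ Algebra.mem_top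
  induction ha using Algebra.adjoin_induction with
  | mem x hx => exact NonUnitalAlgebra.subset_adjoin k hx
  | algebraMap r =>
    rw [Algebra.algebraMap_eq_smul_one]
    exact SMulMemClass.smul_mem r (NonUnitalAlgebra.subset_adjoin k hone)
  | add x y _ _ hx hy => exact add_mem (hx trivial) (hy trivial)
  | mul x y _ _ hx hy => exact mul_mem (hx trivial) (hy trivial)

end MonomialAlgebras

end AlgGrowth

theorem theorem1 (k : Type u) [Field k] :
    -- every growth function of an algebra is equivalent to one of the listed functions
    (∀ f : ℕ → ℕ, AlgGrowth.IsAlgebraGrowth.{u, v} k f →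
      ∃ F : ℕ → ℕ, AlgGrowth.IsAdmissible F ∧ AlgGrowth.AsympEquiv f F) ∧
    -- every listed function is equivalent to the growth function of a hereditary language
    (∀ F : ℕ → ℕ, AlgGrowth.IsAdmissible F →
      ∃ f : ℕ → ℕ, AlgGrowth.IsLanguageGrowth.{w} f ∧ AlgGrowth.AsympEquiv F f) ∧
    -- up to equivalence, all the classes coincide and consist of exactly the listed functions
    (∀ g : ℕ → ℕ, Monotone g → (∀ n, 1 ≤ n → 1 ≤ g n) →
      List.TFAE [
        ∃ F : ℕ → ℕ, AlgGrowth.IsAdmissible F ∧ AlgGrowth.AsympEquiv g F,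
        ∃ f : ℕ → ℕ, AlgGrowth.IsAlgebraGrowth.{u, u} k f ∧ AlgGrowth.AsympEquiv g f,
        ∃ f : ℕ → ℕ, AlgGrowth.IsUnitalAlgebraGrowth.{u, u} k f ∧ AlgGrowth.AsympEquiv g f,
        ∃ f : ℕ → ℕ, AlgGrowth.IsSemigroupGrowth.{w} f ∧ AlgGrowth.AsympEquiv g f,
        ∃ f : ℕ → ℕ, AlgGrowth.IsLanguageGrowth.{w} f ∧ AlgGrowth.AsympEquiv g f]) := by
  refine ⟨fun f hf => hf.exists_admissible, fun F hF => hF.exists_language, fun g _ _ => ?_⟩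
  tfae_have 1 → 5 := by
    rintro ⟨F, hF, hg⟩
    obtain ⟨f, hf, h⟩ := hF.exists_language
    exact ⟨f, hf, hg.trans h⟩
  tfae_have 5 → 4 := by
    rintro ⟨f, hf, hg⟩
    obtain ⟨f', hf', h⟩ := hf.exists_semigroup
    exact ⟨f', hf', hg.trans h⟩
  tfae_have 4 → 1 := by
    rintro ⟨f, hf, hg⟩
    obtain ⟨F, hF, h⟩ := (hf.isAlgebraGrowth k).exists_admissible
    exact ⟨F, hF, hg.trans h⟩
  -- Here the alphabet is taken in `Type`, so that the monomial algebra lives in the universe of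
  -- `k`.
  tfae_have 1 → 3 := by
    rintro ⟨F, hF, hg⟩
    obtain ⟨f, hf, h⟩ := hF.exists_language
    obtain ⟨f', hf', h'⟩ := hf.exists_unital_algebra k
    exact ⟨f', hf', hg.trans (h.trans h')⟩
  tfae_have 3 → 2 := by
    rintro ⟨f, hf, hg⟩
    exact ⟨f, hf.isAlgebraGrowth, hg⟩
  tfae_have 2 → 1 := by
    rintro ⟨f, hf, hg⟩
    obtain ⟨F, hF, h⟩ := hf.exists_admissible
    exact ⟨F, hF, hg.trans h⟩
  tfae_finish
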